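/- Let $L$ be a field, let $\sigma$ be an automorphism of $L$, and let $L^\sigma=\{l\in L : \sigma(l)=l\}$. Let $\mathcal L=L[[X,X^{-1};\sigma]]$ be the skew Laurent series ring: its elements are the series $a=\sum_{i=-\infty}^{n}a_iX^i$ with $n\in\mathbb Z$ and $a_i\in L$, with componentwise addition and the multiplication $ab=\sum_i\bigl(\sum_{j+k=i}a_j\sigma^j(b_k)\bigr)X^i$. It is a division ring. The degree $\deg a$ of $a\neq 0$ is the largest $n$ with $a_n\ne 0$, and $\deg 0=-\infty$. Let $\mathcal L_-=\{a\in\mathcal L : \deg a\le 0\}$; its residue ring $\mathcal L_- /\mathcal L_-X^{-1}$ is identified with $L$ through $a\mapsto a_0$. For $u\in\mathcal L$ let $C(u)$ be the centralizer of $u$ in $\mathcal L$. For $w\in\mathcal L$ with $\deg w$ a nonzero integer let $L^\sigma[[w,w^{-1}]]\subseteq\mathcal L$ be the set of sums of all series $\sum_{i\in\mathbb Z}\lambda_iw^i$, $\lambda_i\in L^\sigma$, that converge in the topology of the valuation $-\deg$ (so $\lambda_i=0$ for all large $i$ if $\deg w>0$, and for all large $-i$ if $\deg w<0$). Suppose that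 $\sigma\neq\mathrm{id}_L$ and that $\sigma^i(l)\neq l$ for all $l\in L\setminus L^\sigma$ and all $i\ge 1$. Then $\mathcal L$ satisfies the commutative centralizer condition, i.e. $\mathcal L$ is noncommutative and the centralizer of every noncentral element of $\mathcal L$ is commutative. Moreover: 1. If $u\in L\setminus L^\sigma$, then $C(u)=L$. 2. If $u\in\mathcal L\setminus L$, $\deg u=0$ and the leading coefficient $u_0$ of $u$ is not in $L^\sigma$, then $C(u)\subseteq\mathcal L_-$, and the map $C(u)\to\mathcal L_- /\mathcal L_-X^{-1}=L$, $c\mapsto c+\mathcal L_-X^{-1}$, is an isomorphism of $L^\sigma$-algebras; moreover $[C(u):L^\sigma(u)]=[L:L^\sigma(u_0)]$ (as cardinals). 3. If $u\in\mathcal L\setminus L$ and $\deg u\neq 0$, then $C(u)$ contains elements of positive degree, and for every $v\in C(u)$ of least positive degree, $C(u)=L^\sigma[[v,v^{-1}]]$, and this is a Laurent series field over $L^\sigma$: sending a formal Laurent series $\sum_i f_iT^i$ over $L^\sigma$ (with $f_i=0$ for all large $-i$) to $\sum_i f_iv^{-i}$ is an isomorphism of $L^\sigma$-algebras $L^\sigma((T))\to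 C(u)$. Moreover $L^\sigma[[u,u^{-1}]]$ is a subfield of $C(u)$, and $[C(u):L^\sigma[[u,u^{-1}]]]=\left|\frac{\deg u}{\deg v}\right|<\infty$. -/

import Mathlib

universe u

/-- The skew Laurent series ring `L[[X, X⁻¹; σ]]`: the elements are the (inverse) Laurent series
`∑_{i ≤ n} aᵢ Xⁱ`, that is, the functions `ℤ → L` that vanish on all large integers. -/
@[ext]
structure SkewLaurent (L : Type u) [Field L] (σ : L ≃+* L) : Type u where
  coeff : ℤ → L
  bdd : ∃ N : ℤ, ∀ n : ℤ, N < n → coeff n = 0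

namespace SkewLaurent

variable {L : Type u} [Field L] {σ : L ≃+* L}

instance : Zero (SkewLaurent L σ) := ⟨⟨fun _ => 0, 0, fun _ _ => rfl⟩⟩

instance : Add (SkewLaurent L σ) := ⟨fun a b => ⟨fun n => a.coeff n + b.coeff n, by
  obtain ⟨A, hA⟩ := a.bdd
  obtain ⟨B, hB⟩ := b.bdd
  exact ⟨max A B, fun n hn => by
    rw [hA n (lt_of_le_of_lt (le_max_left _ _) hn), hB n (lt_of_le_of_lt (le_max_right _ _) hn),
      add_zero]⟩⟩⟩

instance : Neg (SkewLaurent L σ) := ⟨fun a => ⟨fun n => - a.coeff n, by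
  obtain ⟨A, hA⟩ := a.bdd
  exact ⟨A, fun n hn => by rw [hA n hn, neg_zero]⟩⟩⟩

instance : Sub (SkewLaurent L σ) := ⟨fun a b => ⟨fun n => a.coeff n - b.coeff n, by
  obtain ⟨A, hA⟩ := a.bdd
  obtain ⟨B, hB⟩ := b.bdd
  exact ⟨max A B, fun n hn => by
    rw [hA n (lt_of_le_of_lt (le_max_left _ _) hn), hB n (lt_of_le_of_lt (le_max_right _ _) hn),
      sub_zero]⟩⟩⟩

/-- The monomial `l Xⁿ`. -/
def monomial (σ : L ≃+* L) (n : ℤ) (l : L) : SkewLaurent L σ :=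
  ⟨fun m => if m = n then l else 0, n, fun m hm => if_neg (by omega)⟩

instance : One (SkewLaurent L σ) := ⟨monomial σ 0 1⟩

/-- `(a b)ₙ = ∑_{j + k = n} aⱼ σʲ(bₖ)`; only finitely many summands are nonzero. -/
noncomputable instance : Mul (SkewLaurent L σ) :=
  ⟨fun a b => ⟨fun n => ∑ᶠ j : ℤ, a.coeff j * (σ ^ j) (b.coeff (n - j)), by
    obtain ⟨A, hA⟩ := a.bdd
    obtain ⟨B, hB⟩ := b.bdd
    refine ⟨A + B, fun n hn => ?_⟩
    rw [← finsum_zero (α := ℤ)]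
    refine finsum_congr fun j => ?_
    by_cases hj : A < j
    · rw [hA j hj, zero_mul]
    · rw [hB (n - j) (by omega), map_zero, mul_zero]⟩⟩

@[simp] theorem coeff_zero (n : ℤ) : (0 : SkewLaurent L σ).coeff n = 0 := rfl
@[simp] theorem coeff_add (a b : SkewLaurent L σ) (n : ℤ) :
    (a + b).coeff n = a.coeff n + b.coeff n := rfl
@[simp] theorem coeff_neg (a : SkewLaurent L σ) (n : ℤ) : (-a).coeff n = - a.coeff n := rfl
@[simp] theorem coeff_sub (a b : SkewLaurent L σ) (n : ℤ) :
    (a - b).coeff n = a.coeff n - b.coeff n := rfl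
theorem coeff_monomial (k : ℤ) (l : L) (n : ℤ) :
    (monomial σ k l).coeff n = if n = k then l else 0 := rfl
theorem coeff_one (n : ℤ) : (1 : SkewLaurent L σ).coeff n = if n = 0 then 1 else 0 := rfl
theorem coeff_mul (a b : SkewLaurent L σ) (n : ℤ) :
    (a * b).coeff n = ∑ᶠ j : ℤ, a.coeff j * (σ ^ j) (b.coeff (n - j)) := rfl

theorem coeff_mul_eq_sum (a b : SkewLaurent L σ) (n : ℤ) {A B : ℤ}
    (hA : ∀ i, A < i → a.coeff i = 0) (hB : ∀ i, B < i → b.coeff i = 0) (s : Finset ℤ)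
    (hs : Finset.Icc (n - B) A ⊆ s) :
    (a * b).coeff n = ∑ j ∈ s, a.coeff j * (σ ^ j) (b.coeff (n - j)) := by
  rw [coeff_mul]
  refine finsum_eq_sum_of_support_subset _ fun j hj => ?_
  refine hs (Finset.mem_Icc.2 ⟨?_, ?_⟩)
  · by_contra h
    exact hj (by dsimp only; rw [hB (n - j) (by omega), map_zero, mul_zero])
  · by_contra h
    exact hj (by dsimp only; rw [hA j (by omega), zero_mul])

theorem coeff_monomial_mul (k : ℤ) (l : L) (a : SkewLaurent L σ) (n : ℤ) :
    (monomial σ k l * a).coeff n = l * (σ ^ k) (a.coeff (n - k)) := by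
  rw [coeff_mul, finsum_eq_single _ k, coeff_monomial, if_pos rfl]
  intro j hj
  rw [coeff_monomial, if_neg hj, zero_mul]

theorem coeff_mul_monomial (k : ℤ) (l : L) (a : SkewLaurent L σ) (n : ℤ) :
    (a * monomial σ k l).coeff n = a.coeff (n - k) * (σ ^ (n - k)) l := by
  rw [coeff_mul, finsum_eq_single _ (n - k), coeff_monomial, if_pos (by omega)]
  intro j hj
  rw [coeff_monomial, if_neg (by omega), map_zero, mul_zero]

theorem mul_assoc_aux (a b c : SkewLaurent L σ) : a * b * c = a * (b * c) := by
  obtain ⟨A, hA⟩ := a.bdd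
  obtain ⟨B, hB⟩ := b.bdd
  obtain ⟨C, hC⟩ := c.bdd
  have hAB : ∀ i, A + B < i → (a * b).coeff i = 0 := fun i hi => by
    rw [coeff_mul_eq_sum a b i hA hB _ subset_rfl, Finset.Icc_eq_empty (by omega),
      Finset.sum_empty]
  have hBC : ∀ i, B + C < i → (b * c).coeff i = 0 := fun i hi => by
    rw [coeff_mul_eq_sum b c i hB hC _ subset_rfl, Finset.Icc_eq_empty (by omega),
      Finset.sum_empty]
  ext n
  rw [coeff_mul_eq_sum (a * b) c n hAB hC _ subset_rfl,
    coeff_mul_eq_sum a (b * c) n hA hBC _ subset_rfl]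
  have h1 : ∀ j ∈ Finset.Icc (n - C) (A + B), (a * b).coeff j * (σ ^ j) (c.coeff (n - j)) =
      ∑ i ∈ Finset.Icc (n - (B + C)) A,
        a.coeff i * ((σ ^ i) (b.coeff (j - i)) * (σ ^ j) (c.coeff (n - j))) := fun j hj => by
    rw [Finset.mem_Icc] at hj
    rw [coeff_mul_eq_sum a b j hA hB (Finset.Icc (n - (B + C)) A)
      (Finset.Icc_subset_Icc (by omega) le_rfl), Finset.sum_mul]
    exact Finset.sum_congr rfl fun i _ => mul_assoc _ _ _
  rw [Finset.sum_congr rfl h1, Finset.sum_comm]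
  refine Finset.sum_congr rfl fun i hi => ?_
  rw [Finset.mem_Icc] at hi
  rw [coeff_mul_eq_sum b c (n - i) hB hC (Finset.Icc (n - C - i) (A + B - i))
    (Finset.Icc_subset_Icc (by omega) (by omega)), map_sum, ← Finset.mul_sum]
  congr 1
  refine Finset.sum_nbij' (fun j => j - i) (fun k => k + i) ?_ ?_ ?_ ?_ ?_
  · intro j hj
    simp only [Finset.mem_Icc] at hj ⊢
    omega
  · intro j hj
    simp only [Finset.mem_Icc] at hj ⊢
    omega
  · intro j _
    omega
  · intro j _
    omega
  · intro j _
    have e : (σ ^ j) (c.coeff (n - j)) = (σ ^ i) ((σ ^ (j - i)) (c.coeff (n - j))) := by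
      rw [← RingAut.mul_apply, ← zpow_add]
      congr 2
      omega
    rw [e, map_mul]
    congr 4
    omega

theorem left_distrib_aux (a b c : SkewLaurent L σ) : a * (b + c) = a * b + a * c := by
  obtain ⟨A, hA⟩ := a.bdd
  obtain ⟨B, hB⟩ := b.bdd
  obtain ⟨C, hC⟩ := c.bdd
  have hB' : ∀ i, max B C < i → b.coeff i = 0 := fun i hi => hB i (by omega)
  have hC' : ∀ i, max B C < i → c.coeff i = 0 := fun i hi => hC i (by omega)
  have hBC' : ∀ i, max B C < i → (b + c).coeff i = 0 := fun i hi => by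
    rw [coeff_add, hB' i hi, hC' i hi, add_zero]
  ext n
  rw [coeff_add, coeff_mul_eq_sum a b n hA hB' _ subset_rfl,
    coeff_mul_eq_sum a c n hA hC' _ subset_rfl, coeff_mul_eq_sum a (b + c) n hA hBC' _ subset_rfl,
    ← Finset.sum_add_distrib]
  exact Finset.sum_congr rfl fun j _ => by rw [coeff_add, map_add, mul_add]

theorem right_distrib_aux (a b c : SkewLaurent L σ) : (a + b) * c = a * c + b * c := by
  obtain ⟨A, hA⟩ := a.bdd
  obtain ⟨B, hB⟩ := b.bdd
  obtain ⟨C, hC⟩ := c.bdd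
  have hA' : ∀ i, max A B < i → a.coeff i = 0 := fun i hi => hA i (by omega)
  have hB' : ∀ i, max A B < i → b.coeff i = 0 := fun i hi => hB i (by omega)
  have hAB' : ∀ i, max A B < i → (a + b).coeff i = 0 := fun i hi => by
    rw [coeff_add, hA' i hi, hB' i hi, add_zero]
  ext n
  rw [coeff_add, coeff_mul_eq_sum a c n hA' hC _ subset_rfl,
    coeff_mul_eq_sum b c n hB' hC _ subset_rfl, coeff_mul_eq_sum (a + b) c n hAB' hC _ subset_rfl,
    ← Finset.sum_add_distrib]
  exact Finset.sum_congr rfl fun j _ => by rw [coeff_add, add_mul]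

noncomputable instance : Ring (SkewLaurent L σ) where
  add_assoc a b c := by ext n; exact add_assoc _ _ _
  zero_add a := by ext n; exact zero_add _
  add_zero a := by ext n; exact add_zero _
  add_comm a b := by ext n; exact add_comm _ _
  neg_add_cancel a := by ext n; exact neg_add_cancel _
  sub_eq_add_neg a b := by ext n; exact sub_eq_add_neg _ _
  nsmul := nsmulRec
  zsmul := zsmulRec
  mul_assoc := mul_assoc_aux
  one_mul a := by
    ext n
    exact (coeff_monomial_mul 0 1 a n).trans (by simp)
  mul_one a := by
    ext n
    exact (coeff_mul_monomial 0 1 a n).trans (by simp)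
  left_distrib := left_distrib_aux
  right_distrib := right_distrib_aux
  zero_mul a := by
    ext n
    rw [coeff_mul, coeff_zero, ← finsum_zero (α := ℤ)]
    exact finsum_congr fun j => by rw [coeff_zero, zero_mul]
  mul_zero a := by
    ext n
    rw [coeff_mul, coeff_zero, ← finsum_zero (α := ℤ)]
    exact finsum_congr fun j => by rw [coeff_zero, map_zero, mul_zero]

instance : Nontrivial (SkewLaurent L σ) := ⟨⟨0, 1, fun h => by
  have := congrArg (fun a : SkewLaurent L σ => a.coeff 0) h
  simp [coeff_one] at this⟩⟩

/-! The skew Laurent series ring is a division ring. -/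

/-- The coefficients, at `X⁻ˢ`, of the right inverse of a series of degree zero. -/
noncomputable def invCoeff (σ : L ≃+* L) (a : ℤ → L) (s : ℕ) : L :=
  (a 0)⁻¹ * ((if s = 0 then 1 else 0) -
    ∑ j : Fin s, a ((j : ℤ) - s) * (σ ^ ((j : ℤ) - s)) (invCoeff σ a j))
  termination_by s
  decreasing_by exact j.2

theorem exists_right_inv_of_degree_zero (a : SkewLaurent L σ) (h0 : a.coeff 0 ≠ 0)
    (ha : ∀ i, 0 < i → a.coeff i = 0) : ∃ b : SkewLaurent L σ, a * b = 1 := by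
  let b : SkewLaurent L σ :=
    ⟨fun n => if 0 < n then 0 else invCoeff σ a.coeff n.natAbs, 0, fun n hn => if_pos hn⟩
  have hb : ∀ i, 0 < i → b.coeff i = 0 := fun i hi => if_pos hi
  have hb' : ∀ s : ℕ, b.coeff (-(s : ℤ)) = invCoeff σ a.coeff s := fun s => by
    change (if 0 < (-(s : ℤ)) then 0 else invCoeff σ a.coeff (-(s : ℤ)).natAbs) = _
    rw [if_neg (by omega), Int.natAbs_neg, Int.natAbs_natCast]
  refine ⟨b, ?_⟩
  ext n
  rw [coeff_mul_eq_sum a b n ha hb _ subset_rfl, coeff_one]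
  rcases lt_or_ge 0 n with hn | hn
  · rw [Finset.Icc_eq_empty (by omega), Finset.sum_empty, if_neg (by omega)]
  obtain ⟨s, rfl⟩ : ∃ s : ℕ, n = -(s : ℤ) := ⟨n.natAbs, by omega⟩
  have key : ∑ j ∈ Finset.Icc (-(s : ℤ) - 0) 0, a.coeff j * (σ ^ j) (b.coeff (-(s : ℤ) - j)) =
      ∑ j ∈ Finset.range (s + 1),
        a.coeff ((j : ℤ) - s) * (σ ^ ((j : ℤ) - s)) (invCoeff σ a.coeff j) := by
    refine Finset.sum_nbij' (fun j => (j + s).natAbs) (fun k => (k : ℤ) - s) ?_ ?_ ?_ ?_ ?_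
    · intro j hj
      simp only [Finset.mem_Icc, Finset.mem_range] at hj ⊢
      omega
    · intro j hj
      simp only [Finset.mem_Icc, Finset.mem_range] at hj ⊢
      omega
    · intro j hj
      simp only [Finset.mem_Icc] at hj ⊢
      omega
    · intro j hj
      simp only [Finset.mem_range] at hj ⊢
      omega
    · intro j hj
      simp only [Finset.mem_Icc] at hj ⊢
      have e1 : (((j + s).natAbs : ℕ) : ℤ) - s = j := by omega
      have e2 : -(s : ℤ) - j = -(((j + s).natAbs : ℕ) : ℤ) := by omega
      rw [e1, e2, hb']
  rw [key, Finset.sum_range_succ, sub_self, zpow_zero, RingAut.one_apply, invCoeff,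
    mul_inv_cancel_left₀ h0, Finset.sum_range
      (fun j : ℕ => a.coeff ((j : ℤ) - s) * (σ ^ ((j : ℤ) - s)) (invCoeff σ a.coeff j)),
    add_sub_cancel]
  simp

theorem exists_leading {a : SkewLaurent L σ} (ha : a ≠ 0) :
    ∃ n : ℤ, a.coeff n ≠ 0 ∧ ∀ m, n < m → a.coeff m = 0 := by
  obtain ⟨N, hN⟩ := a.bdd
  obtain ⟨k, hk⟩ : ∃ k, a.coeff k ≠ 0 := by
    by_contra h
    push Not at h
    exact ha (by ext n; exact h n)
  obtain ⟨n, hn, hmax⟩ := Int.exists_greatest_of_bdd (P := fun n => a.coeff n ≠ 0)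
    ⟨N, fun z hz => by by_contra h; exact hz (hN z (by omega))⟩ ⟨k, hk⟩
  exact ⟨n, hn, fun m hm => by by_contra h; have := hmax m h; omega⟩

theorem exists_right_inv {a : SkewLaurent L σ} (ha : a ≠ 0) : ∃ b : SkewLaurent L σ, a * b = 1 := by
  obtain ⟨n, hn, hmax⟩ := exists_leading ha
  obtain ⟨b, hb⟩ := exists_right_inv_of_degree_zero (a * monomial σ (-n) 1)
    (by rw [coeff_mul_monomial]; simpa using hn)
    (fun i hi => by rw [coeff_mul_monomial, hmax _ (by omega), zero_mul])
  exact ⟨monomial σ (-n) 1 * b, by rw [← mul_assoc, hb]⟩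

theorem isUnit_or_eq_zero (a : SkewLaurent L σ) : IsUnit a ∨ a = 0 := by
  by_cases ha : a = 0
  · exact Or.inr ha
  refine Or.inl ?_
  obtain ⟨b, hb⟩ := exists_right_inv ha
  have hb0 : b ≠ 0 := by
    rintro rfl
    rw [mul_zero] at hb
    exact zero_ne_one hb
  obtain ⟨c, hc⟩ := exists_right_inv hb0
  have hac : a = c := by
    rw [← mul_one a, ← hc, ← mul_assoc, hb, one_mul]
  exact ⟨⟨a, b, hb, by rw [hac]; exact hc⟩, rfl⟩

noncomputable instance : DivisionRing (SkewLaurent L σ) :=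
  DivisionRing.ofIsUnitOrEqZero isUnit_or_eq_zero

/-- The inclusion `L → L[[X, X⁻¹; σ]]` of the coefficients. -/
noncomputable def const (σ : L ≃+* L) : L →+* SkewLaurent L σ where
  toFun l := monomial σ 0 l
  map_one' := rfl
  map_zero' := by
    ext n
    rw [coeff_monomial, coeff_zero, ite_self]
  map_add' l m := by
    ext n
    rw [coeff_add, coeff_monomial, coeff_monomial, coeff_monomial]
    split_ifs <;> simp
  map_mul' l m := by
    ext n
    rw [coeff_monomial_mul, coeff_monomial, coeff_monomial, sub_zero]
    split_ifs <;> simp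

/-- The degree of a series: the largest `n` with nonzero coefficient at `Xⁿ`, and `-∞` for `0`. -/
noncomputable def degree (a : SkewLaurent L σ) : WithBot ℤ :=
  open Classical in if h : a = 0 then ⊥ else ((exists_leading h).choose : ℤ)

theorem degree_zero : degree (0 : SkewLaurent L σ) = ⊥ := dif_pos rfl

theorem degree_eq_iff (a : SkewLaurent L σ) (n : ℤ) :
    a.degree = n ↔ a.coeff n ≠ 0 ∧ ∀ m, n < m → a.coeff m = 0 := by
  by_cases h : a = 0
  · subst h
    simp [degree_zero]
  · have hs := (exists_leading h).choose_spec
    rw [degree, dif_neg h, WithBot.coe_inj]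
    constructor
    · rintro rfl
      exact hs
    · rintro ⟨h1, h2⟩
      rcases lt_trichotomy (exists_leading h).choose n with hl | hl | hl
      · exact absurd (hs.2 _ hl) h1
      · exact hl
      · exact absurd (h2 _ hl) hs.1

theorem degree_lt_iff (a : SkewLaurent L σ) (n : ℤ) :
    a.degree < n ↔ ∀ m, n ≤ m → a.coeff m = 0 := by
  by_cases h : a = 0
  · subst h
    simp [degree_zero, WithBot.bot_lt_coe]
  · obtain ⟨k, hk⟩ := exists_leading h
    rw [(degree_eq_iff a k).2 hk, WithBot.coe_lt_coe]
    constructor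
    · exact fun hkn m hm => hk.2 m (by omega)
    · intro hz
      by_contra hkn
      exact hk.1 (hz k (by omega))

theorem degree_le_iff (a : SkewLaurent L σ) (n : ℤ) :
    a.degree ≤ n ↔ ∀ m, n < m → a.coeff m = 0 := by
  by_cases h : a = 0
  · subst h
    simp [degree_zero]
  · obtain ⟨k, hk⟩ := exists_leading h
    rw [(degree_eq_iff a k).2 hk, WithBot.coe_le_coe]
    constructor
    · exact fun hkn m hm => hk.2 m (by omega)
    · intro hz
      by_contra hkn
      exact hk.1 (hz k (by omega))

/-- The subfield `L^σ` of the elements of `L` fixed by `σ`. -/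
def fixed (σ : L ≃+* L) : Subfield L := (σ : L →+* L).eqLocusField (RingHom.id L)

theorem zpow_apply_of_mem_fixed {l : L} (hl : l ∈ fixed σ) (n : ℤ) : (σ ^ n) l = l := by
  have h1 : σ l = l := hl
  have h2 : σ ∈ MulAction.stabilizer (RingAut L) l := h1
  exact zpow_mem h2 n

/-- `L[[X, X⁻¹; σ]]` is an algebra over `L^σ`, through the inclusion `L^σ ⊆ L`. -/
noncomputable instance : Algebra (fixed σ) (SkewLaurent L σ) :=
  ((const σ).comp (fixed σ).subtype).toAlgebra' fun l a => by
    ext n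
    refine (coeff_monomial_mul 0 (l : L) a n).trans
      (Eq.trans ?_ (coeff_mul_monomial 0 (l : L) a n).symm)
    rw [zpow_apply_of_mem_fixed l.2, sub_zero, zpow_zero, RingAut.one_apply, mul_comm]

theorem algebraMap_apply (l : fixed σ) :
    algebraMap (fixed σ) (SkewLaurent L σ) l = const σ (l : L) := rfl

/-- The subalgebra of the series of degree at most zero (the skew power series in `X⁻¹`). -/
noncomputable def nonpos (σ : L ≃+* L) : Subalgebra (fixed σ) (SkewLaurent L σ) where
  carrier := {a | a.degree ≤ ((0 : ℤ) : WithBot ℤ)}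
  mul_mem' {a b} ha hb := by
    rw [Set.mem_ofPred_eq, degree_le_iff] at *
    intro m hm
    rw [coeff_mul_eq_sum a b m ha hb _ subset_rfl, Finset.Icc_eq_empty (by omega),
      Finset.sum_empty]
  add_mem' {a b} ha hb := by
    rw [Set.mem_ofPred_eq, degree_le_iff] at *
    intro m hm
    rw [coeff_add, ha m hm, hb m hm, add_zero]
  algebraMap_mem' l := by
    rw [Set.mem_ofPred_eq, degree_le_iff]
    exact fun m hm => if_neg (by omega)

theorem mem_nonpos {a : SkewLaurent L σ} :
    a ∈ nonpos σ ↔ ∀ m, 0 < m → a.coeff m = 0 := degree_le_iff a 0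

/-- The canonical surjection from the series of degree at most zero onto their residue field `L`,
`∑_{i ≤ 0} aᵢ Xⁱ ↦ a₀`; its kernel is the maximal ideal, see `residue_eq_zero_iff`. -/
noncomputable def residue (σ : L ≃+* L) : nonpos σ →ₐ[fixed σ] L where
  toFun a := (a : SkewLaurent L σ).coeff 0
  map_one' := rfl
  map_zero' := rfl
  map_add' _ _ := rfl
  map_mul' a b := by
    change ((a : SkewLaurent L σ) * b).coeff 0 = _
    rw [coeff_mul_eq_sum _ _ 0 (mem_nonpos.1 a.2) (mem_nonpos.1 b.2) _ subset_rfl]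
    simp
  commutes' _ := rfl

theorem residue_surjective (σ : L ≃+* L) : Function.Surjective (residue σ) := fun l =>
  ⟨⟨const σ l, mem_nonpos.2 fun _ hm => if_neg (by omega)⟩, rfl⟩

/-- The kernel of `residue` is generated by `X⁻¹`. -/
theorem residue_eq_zero_iff (a : nonpos σ) :
    residue σ a = 0 ↔ ∃ b : nonpos σ, (a : SkewLaurent L σ) = b * monomial σ (-1) 1 := by
  constructor
  · intro h
    refine ⟨⟨(a : SkewLaurent L σ) * monomial σ 1 1, mem_nonpos.2 fun m hm => ?_⟩, ?_⟩
    · rw [coeff_mul_monomial]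
      rcases eq_or_lt_of_le (show (0 : ℤ) ≤ m - 1 by omega) with h0 | h0
      · rw [← h0, show (a : SkewLaurent L σ).coeff 0 = 0 from h, zero_mul]
      · rw [mem_nonpos.1 a.2 _ h0, zero_mul]
    · ext n
      rw [coeff_mul_monomial, coeff_mul_monomial, map_one, map_one, mul_one, mul_one]
      congr 1
      omega
  · rintro ⟨b, hb⟩
    change (a : SkewLaurent L σ).coeff 0 = 0
    rw [hb, coeff_mul_monomial, mem_nonpos.1 b.2 _ (by omega), zero_mul]

/-- `HasSeriesSum f a`: the series `∑ᵢ fᵢ` converges to `a` in the topology of the valuation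
`-degree`, i.e. the degrees of the differences between `a` and the finite partial sums tend
to `-∞`. -/
def HasSeriesSum (f : ℤ → SkewLaurent L σ) (a : SkewLaurent L σ) : Prop :=
  ∀ N : ℤ, ∀ᶠ s : Finset ℤ in Filter.atTop, (a - ∑ i ∈ s, f i).degree < (N : WithBot ℤ)

/-- `L^σ[[w, w⁻¹]]` inside `L[[X, X⁻¹; σ]]`, for `w` of nonzero degree: the sums of all convergent
series `∑ᵢ λᵢ wⁱ` with `λᵢ ∈ L^σ`. Convergence forces `λᵢ = 0` for all large `i` if `w` has
positive degree, and `λᵢ = 0` for all large `-i` if `w` has negative degree. -/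
def laurentSet (w : SkewLaurent L σ) : Set (SkewLaurent L σ) :=
  {a | ∃ c : ℤ → fixed σ, HasSeriesSum (fun i => const σ (c i : L) * w ^ i) a}

/-- The centralizer `C(u)`, an algebra over `L^σ`. -/
noncomputable def C (u : SkewLaurent L σ) : Subalgebra (fixed σ) (SkewLaurent L σ) :=
  Subalgebra.centralizer (fixed σ) {u}

end SkewLaurent

/-- The commutative centralizer condition: the ring is not commutative, and the centralizer of
every noncentral element is commutative. -/
def CommutativeCentralizerCondition (A : Type u) [Ring A] : Prop :=
  (∃ a b : A, a * b ≠ b * a) ∧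
    ∀ a : A, a ∉ Subring.center A →
      ∀ x ∈ Subring.centralizer {a}, ∀ y ∈ Subring.centralizer {a}, x * y = y * x

/-- The dimension `[T : S]` of `T` as a left module over its subring `S`. -/
noncomputable def relDim {A : Type u} [Ring A] {S T : Subring A} (h : S ≤ T) : Cardinal.{u} :=
  letI : Module S T := Module.compHom T (Subring.inclusion h)
  Module.rank S T

/-! Everything rests on leading coefficients. If `a` and `b` have degrees `A` and `B`, the top
coefficient of `a * b` is `a_A σ^A(b_B)`, so degrees add. The hypothesis on orbits turns any
equation `σ^n(l) = l` with `n ≠ 0` into `l ∈ L^σ`.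

Suppose `deg u = 0` and `u₀ ∉ L^σ`. Then `u` is conjugate to the constant `u₀`: in `x u = u₀ x` the
coefficient of `x` at `X⁻ˢ`, `s ≥ 1`, is determined by the earlier ones, because it occurs
multiplied by `u₀ - σ⁻ˢ(u₀) ≠ 0` (`exists_mul_eq_const_mul`). Comparing coefficients shows that `u₀`
has centralizer `L`, so `C(u) = x⁻¹ L x`. As `x` has leading coefficient `1`, this conjugation
preserves residues, and it fixes `L^σ` (`exists_ringHom_range_eq_C`). Residue field and dimension
are then read off in `L`.

Suppose `deg u = d ≠ 0`. An element of `C(u)` of degree at most `0` has its constant coefficient in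
`L^σ` (`coeff_mem_fixed_of_mem_C`), so two elements of `C(u)` of equal degree are proportional over
`L^σ` up to lower terms. All degrees in `C(u)` are multiples of the least positive one, `t = deg v`.
Successive subtraction therefore expands each element of `C(u)` in any family `e_m ∈ C(u)` with `deg
e_m = m t` (`exists_expansion`). The family `v^m` gives `C(u) = L^σ[[v, v⁻¹]]`. The family `w^q
v^r`, with `w = u` or `u⁻¹` and `0 ≤ r < n = |d| / t`, gives the basis `1, …, v^(n-1)` over `L^σ[[u,
u⁻¹]]`.

Both kinds of centralizer are isomorphic to fields, and subtracting a constant of `L^σ` brings every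
noncentral element into one of the two cases. -/

theorem relDim_eq_rank {A : Type u} [Ring A] {S T : Subring A} (h : S ≤ T) {R M : Type u}
    [Semiring R] [AddCommMonoid M] [Module R M] (i : R → S) (j : M ≃+ T)
    (hi : Function.Bijective i) (hc : ∀ r m, (j (r • m) : A) = (i r : A) * (j m : A)) :
    relDim h = Module.rank R M := by
  let _ : Module S T := Module.compHom T (Subring.inclusion h)
  exact (rank_eq_of_equiv_equiv i j hi fun r m => Subtype.ext (hc r m)).symm

namespace SkewLaurent

open Filter

variable {L : Type u} [Field L] {σ : L ≃+* L}

/-! ### Degrees of products, inverses and powers -/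

theorem coeff_mul_of_lt {a b : SkewLaurent L σ} {A B n : ℤ} (hA : ∀ i, A < i → a.coeff i = 0)
    (hB : ∀ i, B < i → b.coeff i = 0) (hn : A + B < n) : (a * b).coeff n = 0 := by
  rw [coeff_mul_eq_sum a b n hA hB _ subset_rfl, Finset.Icc_eq_empty (by omega), Finset.sum_empty]

theorem coeff_mul_top {a b : SkewLaurent L σ} {A B : ℤ} (hA : ∀ i, A < i → a.coeff i = 0)
    (hB : ∀ i, B < i → b.coeff i = 0) :
    (a * b).coeff (A + B) = a.coeff A * (σ ^ A) (b.coeff B) := by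
  rw [coeff_mul_eq_sum a b (A + B) hA hB _ subset_rfl, add_sub_cancel_right, Finset.Icc_self,
    Finset.sum_singleton, add_sub_cancel_left]

theorem coeff_const (l : L) (n : ℤ) : (const σ l).coeff n = if n = 0 then l else 0 := rfl

theorem coeff_const_mul (l : L) (a : SkewLaurent L σ) (n : ℤ) :
    (const σ l * a).coeff n = l * a.coeff n := by
  refine (coeff_monomial_mul 0 l a n).trans ?_
  simp

theorem coeff_mul_const (l : L) (a : SkewLaurent L σ) (n : ℤ) :
    (a * const σ l).coeff n = a.coeff n * (σ ^ n) l := by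
  refine (coeff_mul_monomial 0 l a n).trans ?_
  simp

theorem coeff_sum {ι : Type*} (s : Finset ι) (f : ι → SkewLaurent L σ) (n : ℤ) :
    (∑ i ∈ s, f i).coeff n = ∑ i ∈ s, (f i).coeff n := by
  classical
  induction s using Finset.induction_on with
  | empty => simp
  | insert i s hi ih => rw [Finset.sum_insert hi, Finset.sum_insert hi, coeff_add, ih]

theorem ne_zero_of_degree_eq {a : SkewLaurent L σ} {n : ℤ} (ha : a.degree = n) : a ≠ 0 := by
  rintro rfl
  rw [degree_zero] at ha
  exact WithBot.bot_ne_coe ha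

theorem exists_degree_eq {a : SkewLaurent L σ} (ha : a ≠ 0) : ∃ n : ℤ, a.degree = n := by
  obtain ⟨n, hn⟩ := exists_leading ha
  exact ⟨n, (degree_eq_iff a n).2 hn⟩

theorem eq_zero_of_degree_lt {a : SkewLaurent L σ} (h : ∀ N : ℤ, a.degree < N) : a = 0 := by
  by_contra ha
  obtain ⟨n, hn⟩ := exists_degree_eq ha
  exact (h n).ne hn

theorem degree_mul_eq {a b : SkewLaurent L σ} {n m : ℤ} (ha : a.degree = n) (hb : b.degree = m) :
    (a * b).degree = ((n + m : ℤ) : WithBot ℤ) := by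
  rw [degree_eq_iff] at *
  refine ⟨?_, fun k hk => coeff_mul_of_lt ha.2 hb.2 hk⟩
  rw [coeff_mul_top ha.2 hb.2]
  exact mul_ne_zero ha.1 ((map_ne_zero _).2 hb.1)

theorem degree_one : (1 : SkewLaurent L σ).degree = ((0 : ℤ) : WithBot ℤ) := by
  rw [degree_eq_iff]
  refine ⟨by simp [coeff_one], fun m hm => ?_⟩
  rw [coeff_one, if_neg (by omega)]

theorem degree_inv_eq {a : SkewLaurent L σ} {n : ℤ} (ha : a.degree = n) :
    a⁻¹.degree = ((-n : ℤ) : WithBot ℤ) := by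
  have h0 := ne_zero_of_degree_eq ha
  obtain ⟨m, hm⟩ := exists_degree_eq (inv_ne_zero h0)
  have h := degree_mul_eq ha hm
  rw [mul_inv_cancel₀ h0, degree_one, WithBot.coe_inj] at h
  rw [hm, show m = -n by omega]

theorem degree_pow_eq {a : SkewLaurent L σ} {n : ℤ} (ha : a.degree = n) (i : ℕ) :
    (a ^ i).degree = ((i * n : ℤ) : WithBot ℤ) := by
  induction i with
  | zero => simpa using degree_one
  | succ i ih =>
    rw [pow_succ, degree_mul_eq ih ha, WithBot.coe_inj]
    push_cast
    ring

theorem degree_zpow_eq {a : SkewLaurent L σ} {n : ℤ} (ha : a.degree = n) (i : ℤ) :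
    (a ^ i).degree = ((i * n : ℤ) : WithBot ℤ) := by
  obtain ⟨k, rfl | rfl⟩ := i.eq_nat_or_neg
  · rw [zpow_natCast, degree_pow_eq ha]
  · rw [zpow_neg, zpow_natCast, degree_inv_eq (degree_pow_eq ha k), neg_mul]

theorem degree_sub_lt {a b : SkewLaurent L σ} {N : ℤ} (ha : a.degree < N) (hb : b.degree < N) :
    (a - b).degree < N := by
  rw [degree_lt_iff] at *
  intro m hm
  rw [coeff_sub, ha m hm, hb m hm, sub_zero]

theorem degree_add_lt {a b : SkewLaurent L σ} {N : ℤ} (ha : a.degree < N) (hb : b.degree < N) :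
    (a + b).degree < N := by
  rw [degree_lt_iff] at *
  intro m hm
  rw [coeff_add, ha m hm, hb m hm, add_zero]

theorem degree_sum_lt {ι : Type*} {s : Finset ι} {f : ι → SkewLaurent L σ} {N : ℤ}
    (h : ∀ i ∈ s, (f i).degree < N) : (∑ i ∈ s, f i).degree < N := by
  rw [degree_lt_iff]
  intro m hm
  rw [coeff_sum]
  exact Finset.sum_eq_zero fun i hi => (degree_lt_iff _ _).1 (h i hi) m hm

theorem degree_mul_lt {a b : SkewLaurent L σ} {M N : ℤ} (ha : a.degree < N)
    (hb : ∀ i, M < i → b.coeff i = 0) : (a * b).degree < ((N + M : ℤ) : WithBot ℤ) := by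
  rw [degree_lt_iff] at *
  exact fun m hm => coeff_mul_of_lt (A := N - 1) (fun i hi => ha i (by omega)) hb (by omega)

theorem degree_mul_lt' {a b : SkewLaurent L σ} {M N : ℤ} (ha : ∀ i, M < i → a.coeff i = 0)
    (hb : b.degree < N) : (a * b).degree < ((M + N : ℤ) : WithBot ℤ) := by
  rw [degree_lt_iff] at *
  exact fun m hm => coeff_mul_of_lt (B := N - 1) ha (fun i hi => hb i (by omega)) (by omega)

theorem degree_const_mul_lt {a : SkewLaurent L σ} {N : ℤ} (ha : a.degree < N) (l : L) :
    (const σ l * a).degree < N := by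
  rw [degree_lt_iff] at *
  intro m hm
  rw [coeff_const_mul, ha m hm, mul_zero]

theorem degree_const_mul_eq {a : SkewLaurent L σ} {n : ℤ} (ha : a.degree = n) {l : L}
    (hl : l ≠ 0) : (const σ l * a).degree = n := by
  rw [degree_eq_iff] at *
  refine ⟨?_, fun m hm => ?_⟩
  · rw [coeff_const_mul]
    exact mul_ne_zero hl ha.1
  · rw [coeff_const_mul, ha.2 m hm, mul_zero]

theorem const_fixed_mul_comm (c : fixed σ) (a : SkewLaurent L σ) :
    const σ (c : L) * a = a * const σ (c : L) :=
  Algebra.commutes c a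

/-! ### Convergent series -/

theorem HasSeriesSum.unique {f : ℤ → SkewLaurent L σ} {a b : SkewLaurent L σ}
    (ha : HasSeriesSum f a) (hb : HasSeriesSum f b) : a = b := by
  rw [← sub_eq_zero]
  refine eq_zero_of_degree_lt fun N => ?_
  obtain ⟨s, h1, h2⟩ := ((ha N).and (hb N)).exists
  have := degree_sub_lt h1 h2
  rwa [sub_sub_sub_cancel_right] at this

theorem HasSeriesSum.add {f g : ℤ → SkewLaurent L σ} {a b : SkewLaurent L σ}
    (ha : HasSeriesSum f a) (hb : HasSeriesSum g b) :
    HasSeriesSum (fun i => f i + g i) (a + b) := fun N => by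
  filter_upwards [ha N, hb N] with s h1 h2
  rw [Finset.sum_add_distrib, add_sub_add_comm]
  exact degree_add_lt h1 h2

theorem hasSeriesSum_zero : HasSeriesSum (fun _ => (0 : SkewLaurent L σ)) 0 := fun N =>
  Eventually.of_forall fun s => by
    simp [degree_zero, WithBot.bot_lt_coe]

theorem HasSeriesSum.sum {ι : Type*} {s : Finset ι} {f : ι → ℤ → SkewLaurent L σ}
    {a : ι → SkewLaurent L σ} (h : ∀ i ∈ s, HasSeriesSum (f i) (a i)) :
    HasSeriesSum (fun m => ∑ i ∈ s, f i m) (∑ i ∈ s, a i) := by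
  classical
  induction s using Finset.induction_on with
  | empty => simpa using hasSeriesSum_zero
  | insert i s hi ih =>
    simp only [Finset.sum_insert hi]
    exact (h i (Finset.mem_insert_self i s)).add
      (ih fun j hj => h j (Finset.mem_insert_of_mem hj))

theorem HasSeriesSum.mul_right {f : ℤ → SkewLaurent L σ} {a : SkewLaurent L σ}
    (h : HasSeriesSum f a) (b : SkewLaurent L σ) : HasSeriesSum (fun i => f i * b) (a * b) := by
  intro N
  obtain ⟨B, hB⟩ := b.bdd
  filter_upwards [h (N - B)] with s hs
  rw [← Finset.sum_mul, ← sub_mul]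
  simpa using degree_mul_lt hs hB

theorem HasSeriesSum.mul_left {f : ℤ → SkewLaurent L σ} {a : SkewLaurent L σ}
    (h : HasSeriesSum f a) (b : SkewLaurent L σ) : HasSeriesSum (fun i => b * f i) (b * a) := by
  intro N
  obtain ⟨B, hB⟩ := b.bdd
  filter_upwards [h (N - B)] with s hs
  rw [← Finset.mul_sum, ← mul_sub]
  simpa using degree_mul_lt' hB hs

/-- A partial sum of `f` over `s` equals the partial sum of `f ∘ e` over the preimage of `s`, and
these preimages tend to infinity with `s`. -/
theorem HasSeriesSum.comp_injective {f : ℤ → SkewLaurent L σ} {a : SkewLaurent L σ} {e : ℤ → ℤ}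
    (he : Function.Injective e) (hf : ∀ i, i ∉ Set.range e → f i = 0)
    (h : HasSeriesSum (fun i => f (e i)) a) : HasSeriesSum f a := by
  intro N
  filter_upwards [(tendsto_finset_preimage_atTop_atTop he).eventually (h N)] with s hs
  rwa [Finset.sum_preimage e s he.injOn f fun i _ hi => hf i hi] at hs

theorem HasSeriesSum.neg_index {f : ℤ → SkewLaurent L σ} {a : SkewLaurent L σ}
    (h : HasSeriesSum f a) : HasSeriesSum (fun i => f (-i)) a :=
  HasSeriesSum.comp_injective (e := fun i => -i) neg_injective
    (fun i hi => absurd ⟨-i, neg_neg i⟩ hi) (by simpa using h)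

theorem hasSeriesSum_of_finset {f : ℤ → SkewLaurent L σ} (s : Finset ℤ)
    (h : ∀ i, i ∉ s → f i = 0) : HasSeriesSum f (∑ i ∈ s, f i) := fun N => by
  filter_upwards [eventually_ge_atTop s] with t ht
  rw [Finset.sum_subset ht fun i _ hi => h i hi, sub_self, degree_zero]
  exact WithBot.bot_lt_coe N

/-- The terms of a convergent series tend to zero. -/
theorem HasSeriesSum.finite {f : ℤ → SkewLaurent L σ} {a : SkewLaurent L σ}
    (h : HasSeriesSum f a) (N : ℤ) : {i | ¬ (f i).degree < N}.Finite := by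
  obtain ⟨s, hs⟩ := eventually_atTop.1 (h N)
  refine s.finite_toSet.subset fun i hi => ?_
  by_contra his
  refine hi ?_
  have h1 := hs s le_rfl
  have h2 := hs (insert i s) (Finset.subset_insert i s)
  rw [Finset.sum_insert (by simpa using his)] at h2
  have := degree_sub_lt h1 h2
  rwa [sub_sub_sub_cancel_left, add_sub_cancel_right] at this

theorem HasSeriesSum.degree_lt {f : ℤ → SkewLaurent L σ} {a : SkewLaurent L σ}
    (h : HasSeriesSum f a) {N : ℤ} (hf : ∀ i, (f i).degree < N) : a.degree < N := by
  obtain ⟨s, hs⟩ := (h N).exists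
  have := degree_add_lt hs (degree_sum_lt (s := s) fun i _ => hf i)
  rwa [sub_add_cancel] at this

/-- A series whose terms tend to zero converges. -/
theorem exists_hasSeriesSum {f : ℤ → SkewLaurent L σ}
    (hf : ∀ N : ℤ, {i | ¬ (f i).degree < N}.Finite) : ∃ a, HasSeriesSum f a := by
  have hsupp : ∀ N n : ℤ, N ≤ n →
      (Function.support fun i => (f i).coeff n) ⊆ {i | ¬ (f i).degree < N} :=
    fun N n hn i hi h => hi ((degree_lt_iff _ _).1 h n hn)
  -- A common degree bound exists because all but finitely many terms have negative degree. The sum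
  -- is then formed coefficientwise, with finitely many contributions to each coefficient.
  obtain ⟨M, hM⟩ : ∃ M : ℤ, ∀ i, ∀ n, M < n → (f i).coeff n = 0 := by
    choose B hB using fun i => (f i).bdd
    obtain ⟨K, hK⟩ := ((hf 0).image B).bddAbove
    refine ⟨max K 0, fun i n hn => ?_⟩
    by_cases hi : (f i).degree < ((0 : ℤ) : WithBot ℤ)
    · exact (degree_lt_iff _ _).1 hi n (by omega)
    · have := hK ⟨i, hi, rfl⟩
      exact hB i n (by omega)
  refine ⟨⟨fun n => ∑ᶠ i, (f i).coeff n, M, fun n hn => ?_⟩, fun N => ?_⟩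
  · simp [hM _ n hn]
  · filter_upwards [eventually_ge_atTop (hf N).toFinset] with s hs
    rw [degree_lt_iff]
    intro m hm
    rw [coeff_sub, coeff_sum, sub_eq_zero]
    refine finsum_eq_sum_of_support_subset _ ((hsupp N m hm).trans fun i hi => ?_)
    exact hs ((hf N).mem_toFinset.2 hi)

/-! ### Series in a family with one member in each multiple of a positive degree -/

section Family

variable {t : ℤ} {e : ℤ → SkewLaurent L σ}

theorem finite_of_degree_eq (ht : 0 < t) (he : ∀ m, (e m).degree = ((m * t : ℤ) : WithBot ℤ))
    {c : ℤ → L} {M : ℤ} (hc : ∀ m, M < m → c m = 0) (N : ℤ) :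
    {i | ¬ (const σ (c i) * e i).degree < N}.Finite := by
  -- For `i < min N 0` the index is negative, so `i * t ≤ i < N`.
  refine (Set.finite_Icc (min N 0) M).subset fun i hi => ?_
  by_contra h
  apply hi
  rw [Set.mem_Icc, not_and_or] at h
  rcases h with h | h
  · apply degree_const_mul_lt
    rw [he, WithBot.coe_lt_coe]
    nlinarith [min_le_left N 0, min_le_right N 0]
  · rw [hc i (by omega), map_zero, zero_mul, degree_zero]
    exact WithBot.bot_lt_coe N

theorem exists_hasSeriesSum_family (ht : 0 < t)
    (he : ∀ m, (e m).degree = ((m * t : ℤ) : WithBot ℤ))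
    {c : ℤ → L} {M : ℤ} (hc : ∀ m, M < m → c m = 0) :
    ∃ a, HasSeriesSum (fun i => const σ (c i) * e i) a :=
  exists_hasSeriesSum (finite_of_degree_eq ht he hc)

theorem exists_bound_of_hasSeriesSum (ht : 0 < t)
    (he : ∀ m, (e m).degree = ((m * t : ℤ) : WithBot ℤ)) {c : ℤ → L} {a : SkewLaurent L σ}
    (h : HasSeriesSum (fun i => const σ (c i) * e i) a) : ∃ M : ℤ, ∀ m, M < m → c m = 0 := by
  obtain ⟨M, hM⟩ := (h.finite 0).bddAbove
  refine ⟨max M 0, fun m hm => ?_⟩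
  by_contra hcm
  have : m ∈ {i | ¬ (const σ (c i) * e i).degree < ((0 : ℤ) : WithBot ℤ)} := by
    rw [Set.mem_ofPred_eq, degree_const_mul_eq (he m) hcm, WithBot.coe_lt_coe]
    have : 0 < m * t := mul_pos (by omega) ht
    omega
  have := hM this
  omega

/-- If `n` is the largest index with `c n ≠ 0`, only the `n`-th term reaches degree `n * t`, so
nothing can cancel it. This is uniqueness of expansions. -/
theorem coeffs_eq_zero_of_hasSeriesSum_zero (ht : 0 < t)
    (he : ∀ m, (e m).degree = ((m * t : ℤ) : WithBot ℤ)) {c : ℤ → L}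
    (h : HasSeriesSum (fun i => const σ (c i) * e i) 0) (m : ℤ) : c m = 0 := by
  by_contra hm
  obtain ⟨M, hM⟩ := exists_bound_of_hasSeriesSum ht he h
  obtain ⟨n, hn, hmax⟩ := Int.exists_greatest_of_bdd (P := fun n => c n ≠ 0)
    ⟨M, fun z hz => by by_contra h; exact hz (hM z (by omega))⟩ ⟨m, hm⟩
  obtain ⟨s, hs, hns⟩ := ((h (n * t)).and (eventually_ge_atTop {n})).exists
  have hns : n ∈ s := hns (Finset.mem_singleton_self n)
  have h1 := (degree_lt_iff _ _).1 hs (n * t) le_rfl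
  rw [coeff_sub, coeff_zero, zero_sub, neg_eq_zero, coeff_sum,
    Finset.sum_eq_single_of_mem n hns] at h1
  · exact ((degree_eq_iff _ _).1 (degree_const_mul_eq (he n) hn)).1 h1
  · intro i _ hin
    rcases lt_or_gt_of_ne hin with hlt | hgt
    · have : i * t < n * t := mul_lt_mul_of_pos_right hlt ht
      rw [coeff_const_mul, ((degree_eq_iff _ _).1 (he i)).2 _ this, mul_zero]
    · have : c i = 0 := by
        by_contra hi
        have := hmax i hi
        omega
      rw [this, map_zero, zero_mul, coeff_zero]

end Family

/-! ### Centralizers -/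

theorem mem_C {u z : SkewLaurent L σ} : z ∈ C u ↔ u * z = z * u := by
  rw [C, Subalgebra.mem_centralizer_iff]
  simp

theorem self_mem_C (u : SkewLaurent L σ) : u ∈ C u := mem_C.2 rfl

theorem inv_mem_C {u z : SkewLaurent L σ} (h : z ∈ C u) : z⁻¹ ∈ C u :=
  mem_C.2 ((show Commute u z from mem_C.1 h).inv_right₀)

theorem zpow_mem_C {u z : SkewLaurent L σ} (h : z ∈ C u) (n : ℤ) : z ^ n ∈ C u :=
  mem_C.2 ((show Commute u z from mem_C.1 h).zpow_right₀ n)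

theorem const_fixed_mem_C (u : SkewLaurent L σ) (c : fixed σ) : const σ (c : L) ∈ C u :=
  (C u).algebraMap_mem c

/-- Centralizers are closed under the summation of series. -/
theorem HasSeriesSum.mem_C {u a : SkewLaurent L σ} {f : ℤ → SkewLaurent L σ}
    (h : HasSeriesSum f a) (hf : ∀ i, f i ∈ C u) : a ∈ C u := by
  rw [SkewLaurent.mem_C]
  refine (h.mul_left u).unique ?_
  simp only [SkewLaurent.mem_C.1 (hf _)]
  exact h.mul_right u

theorem mem_fixed_of_zpow_apply (horb : ∀ l : L, l ∉ fixed σ → ∀ i : ℕ, 1 ≤ i → (σ ^ i) l ≠ l)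
    {l : L} {n : ℤ} (hn : n ≠ 0) (h : (σ ^ n) l = l) : l ∈ fixed σ := by
  by_contra hl
  obtain ⟨k, rfl | rfl⟩ := n.eq_nat_or_neg
  · exact horb l hl k (by omega) (by rwa [zpow_natCast] at h)
  · refine horb l hl k (by omega) ?_
    have h2 := congrArg (σ ^ (k : ℤ)) h
    rw [← RingAut.mul_apply, ← zpow_add, add_neg_cancel, zpow_zero, RingAut.one_apply,
      zpow_natCast] at h2
    exact h2.symm

/-- Comparing coefficients of `X^d` in `u z = z u` gives `u_d σ^d(z₀) = z₀ u_d`, hence `σ^d(z₀) =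
z₀` with `d ≠ 0`. -/
theorem coeff_mem_fixed_of_mem_C
    (horb : ∀ l : L, l ∉ fixed σ → ∀ i : ℕ, 1 ≤ i → (σ ^ i) l ≠ l) {u z : SkewLaurent L σ}
    {d : ℤ} (hd : d ≠ 0) (hu : u.degree = d) (hz : z ∈ C u) (hz0 : ∀ i, 0 < i → z.coeff i = 0) :
    z.coeff 0 ∈ fixed σ := by
  rw [degree_eq_iff] at hu
  have h := congrArg (fun a => coeff a d) (mem_C.1 hz)
  have h1 := coeff_mul_top hu.2 hz0
  have h2 := coeff_mul_top hz0 hu.2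
  rw [add_zero] at h1
  rw [zero_add, zpow_zero, RingAut.one_apply] at h2
  simp only [h1, h2] at h
  rw [mul_comm] at h
  exact mem_fixed_of_zpow_apply horb hd (mul_right_cancel₀ hu.1 h)

/-- Two elements of the centralizer of an element of nonzero degree agree, up to a factor in
`L^σ` and to terms of lower degree. -/
theorem exists_degree_sub_lt
    (horb : ∀ l : L, l ∉ fixed σ → ∀ i : ℕ, 1 ≤ i → (σ ^ i) l ≠ l) {u z e : SkewLaurent L σ}
    {d n : ℤ} (hd : d ≠ 0) (hu : u.degree = d) (hz : z ∈ C u) (he : e ∈ C u) (hen : e.degree = n)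
    (hzn : ∀ i, n < i → z.coeff i = 0) :
    ∃ c : fixed σ, (z - const σ (c : L) * e).degree < n := by
  have he' := (degree_eq_iff _ _).1 (degree_inv_eq hen)
  have hze : ∀ i, 0 < i → (z * e⁻¹).coeff i = 0 := fun i hi =>
    coeff_mul_of_lt hzn he'.2 (by omega)
  -- The quotient `z e⁻¹` lies in `C(u)` and has degree at most `0`; its constant coefficient is the
  -- required factor.
  refine ⟨⟨(z * e⁻¹).coeff 0,
    coeff_mem_fixed_of_mem_C horb hd hu ((C u).mul_mem hz (inv_mem_C he)) hze⟩, ?_⟩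
  have h1 : (z * e⁻¹ - const σ ((z * e⁻¹).coeff 0)).degree < ((0 : ℤ) : WithBot ℤ) := by
    rw [degree_lt_iff]
    intro m hm
    rw [coeff_sub, coeff_const]
    split_ifs with h
    · rw [h, sub_self]
    · rw [hze m (by omega), sub_zero]
  have h2 := degree_mul_lt h1 ((degree_eq_iff _ _).1 hen).2
  rwa [sub_mul, inv_mul_cancel_right₀ (ne_zero_of_degree_eq hen), zero_add] at h2

/-- Division with remainder: `w v^(-(n / t))` lies in `C(u)` and has degree `n % t < t`, which
minimality forces to be `0`. -/
theorem dvd_degree_of_mem_C {u v : SkewLaurent L σ} {t : ℤ} (ht : 0 < t) (hv : v ∈ C u)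
    (hvt : v.degree = t)
    (hmin : ∀ w ∈ C u, ((0 : ℤ) : WithBot ℤ) < w.degree → v.degree ≤ w.degree)
    {w : SkewLaurent L σ} (hw : w ∈ C u) {n : ℤ} (hn : w.degree = n) : t ∣ n := by
  have h1 : (w * v ^ (-(n / t))).degree = ((n % t : ℤ) : WithBot ℤ) := by
    rw [degree_mul_eq hn (degree_zpow_eq hvt _), WithBot.coe_inj]
    have := Int.emod_add_mul_ediv n t
    linarith
  have h2 := Int.emod_nonneg n ht.ne'
  have h3 := Int.emod_lt_of_pos n ht
  refine Int.dvd_of_emod_eq_zero ?_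
  by_contra h4
  have := hmin _ ((C u).mul_mem hw (zpow_mem_C hv _)) (by rw [h1, WithBot.coe_lt_coe]; omega)
  rw [h1, hvt, WithBot.coe_le_coe] at this
  omega

/-- Every element of the centralizer expands in any family of elements of the centralizer that
has one member in each possible degree. -/
theorem exists_expansion
    (horb : ∀ l : L, l ∉ fixed σ → ∀ i : ℕ, 1 ≤ i → (σ ^ i) l ≠ l) {u : SkewLaurent L σ}
    {d t : ℤ} (hd : d ≠ 0) (hu : u.degree = d) (ht : 0 < t)
    (hdvd : ∀ w ∈ C u, ∀ n : ℤ, w.degree = n → t ∣ n) {e : ℤ → SkewLaurent L σ}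
    (heC : ∀ m, e m ∈ C u) (he : ∀ m, (e m).degree = ((m * t : ℤ) : WithBot ℤ))
    {z : SkewLaurent L σ} (hz : z ∈ C u) :
    ∃ c : ℤ → fixed σ, HasSeriesSum (fun i => const σ (c i : L) * e i) z := by
  -- One subtraction lowers the degree below `j * t`, and divisibility by `t` then pushes it down to
  -- `(j - 1) * t`. The hypotheses on `r` stand after the existential so that `choose` yields a
  -- total function, usable in a recursion; its default value is `0`.
  have step : ∀ (j : ℤ) (r : SkewLaurent L σ), ∃ c : fixed σ, r ∈ C u →
      (∀ i, j * t < i → r.coeff i = 0) →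
      ∀ i, (j - 1) * t < i → (r - const σ (c : L) * e j).coeff i = 0 := by
    intro j r
    by_cases hr : r ∈ C u ∧ ∀ i, j * t < i → r.coeff i = 0
    · obtain ⟨c, hc⟩ := exists_degree_sub_lt horb hd hu hr.1 (heC j) (he j) hr.2
      refine ⟨c, fun _ _ => ?_⟩
      by_cases h0 : r - const σ (c : L) * e j = 0
      · simp [h0]
      obtain ⟨n, hn⟩ := exists_degree_eq h0
      obtain ⟨q, rfl⟩ := hdvd _
        ((C u).sub_mem hr.1 ((C u).mul_mem (const_fixed_mem_C u c) (heC j))) n hn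
      rw [hn, WithBot.coe_lt_coe] at hc
      have hq : q < j := by
        by_contra hq
        have := mul_le_mul_of_nonneg_left (not_lt.1 hq) ht.le
        linarith
      have hq' : t * q ≤ (j - 1) * t := by
        rw [mul_comm]
        exact mul_le_mul_of_nonneg_right (by omega) ht.le
      exact fun i hi => ((degree_eq_iff _ _).1 hn).2 i (by omega)
    · exact ⟨0, fun h1 h2 => absurd ⟨h1, h2⟩ hr⟩
  choose Λ hΛ using step
  obtain ⟨B, hB⟩ := z.bdd
  obtain ⟨M, hM⟩ : ∃ M : ℤ, B ≤ M * t := ⟨max B 0, by nlinarith [le_max_left B 0, le_max_right B 0]⟩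
  -- The remainder after subtracting the `s` terms of index `M, M - 1, …, M - s + 1`.
  let rem : ℕ → SkewLaurent L σ := fun s =>
    Nat.rec z (fun s r => r - const σ (Λ (M - s) r : L) * e (M - s)) s
  have rem_succ : ∀ s : ℕ, rem (s + 1) =
      rem s - const σ (Λ (M - s) (rem s) : L) * e (M - s) := fun s => rfl
  have hrC : ∀ s, rem s ∈ C u := by
    intro s
    induction s with
    | zero => exact hz
    | succ s ih =>
      rw [rem_succ]
      exact (C u).sub_mem ih ((C u).mul_mem (const_fixed_mem_C u _) (heC _))
  have hrd : ∀ s : ℕ, ∀ i, (M - s) * t < i → (rem s).coeff i = 0 := by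
    intro s
    induction s with
    | zero => exact fun i hi => hB i (by simp at hi; omega)
    | succ s ih =>
      rw [rem_succ]
      have := hΛ (M - s) (rem s) (hrC s) ih
      rwa [show (M - (s : ℤ) - 1) = M - ((s + 1 : ℕ) : ℤ) by push_cast; ring] at this
  let c : ℤ → fixed σ := fun m => if M < m then 0 else Λ m (rem (M - m).toNat)
  have hc1 : ∀ m, M < m → c m = 0 := fun m hm => if_pos hm
  have hc2 : ∀ s : ℕ, c (M - s) = Λ (M - s) (rem s) := fun s => by
    simp only [c]
    rw [if_neg (by omega), show (M - (M - (s : ℤ))).toNat = s by omega]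
  have hsum : ∀ s : ℕ, z - ∑ m ∈ Finset.Ioc (M - s) M, const σ (c m : L) * e m = rem s := by
    intro s
    induction s with
    | zero => simp [rem]
    | succ s ih =>
      have : Finset.Ioc (M - ((s + 1 : ℕ) : ℤ)) M = insert (M - (s : ℤ)) (Finset.Ioc (M - s) M) := by
        ext m
        simp only [Finset.mem_insert, Finset.mem_Ioc]
        omega
      rw [this, Finset.sum_insert (by simp), rem_succ, ← hc2 s, ← ih]
      abel
  refine ⟨c, fun N => ?_⟩
  obtain ⟨s, hs⟩ : ∃ s : ℕ, (M - s) * t < N := by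
    -- This makes `M - s ≤ -(|N| + 1)`, and multiplication by `t ≥ 1` keeps the value below `N`.
    refine ⟨(M + |N| + 1).toNat, ?_⟩
    have h1 : M - ((M + |N| + 1).toNat : ℤ) ≤ -(|N| + 1) := by omega
    have h2 := abs_nonneg N
    have h3 := neg_abs_le N
    nlinarith
  filter_upwards [eventually_ge_atTop (Finset.Ioc (M - s) M)] with S hS
  rw [← Finset.sum_sdiff hS, add_comm, ← sub_sub, hsum]
  refine degree_sub_lt ((degree_lt_iff _ _).2 fun i hi => hrd s i (by omega))
    (degree_sum_lt fun i hi => ?_)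
  rw [Finset.mem_sdiff, Finset.mem_Ioc, not_and_or] at hi
  rcases hi.2 with h | h
  · apply degree_const_mul_lt
    rw [he, WithBot.coe_lt_coe]
    have := mul_le_mul_of_nonneg_right (not_lt.1 h) ht.le
    omega
  · rw [hc1 i (by omega)]
    simp [degree_zero, WithBot.bot_lt_coe]

/-! ### Laurent series in an element of positive degree -/

theorem exists_laurentSum {w : SkewLaurent L σ} {t : ℤ} (ht : 0 < t) (hw : w.degree = t)
    (f : LaurentSeries (fixed σ)) :
    ∃ a, HasSeriesSum (fun i => const σ (f.coeff i : L) * w ^ (-i)) a := by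
  obtain ⟨a, ha⟩ := exists_hasSeriesSum_family (c := fun i => (f.coeff (-i) : L)) (M := -f.order) ht
    (fun m => degree_zpow_eq hw m) fun m hm => by
      rw [HahnSeries.coeff_eq_zero_of_lt_order (by omega)]
      rfl
  exact ⟨a, by simpa using ha.neg_index⟩

/-- The sum of the Laurent series with coefficients `f` in `w⁻¹`. -/
noncomputable def laurentSum {w : SkewLaurent L σ} {t : ℤ} (ht : 0 < t) (hw : w.degree = t)
    (f : LaurentSeries (fixed σ)) : SkewLaurent L σ := (exists_laurentSum ht hw f).choose

section LaurentSum

variable {w : SkewLaurent L σ} {t : ℤ} (ht : 0 < t) (hw : w.degree = t)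

theorem hasSeriesSum_laurentSum (f : LaurentSeries (fixed σ)) :
    HasSeriesSum (fun i => const σ (f.coeff i : L) * w ^ (-i)) (laurentSum ht hw f) :=
  (exists_laurentSum ht hw f).choose_spec

theorem laurentSum_add (f g : LaurentSeries (fixed σ)) :
    laurentSum ht hw (f + g) = laurentSum ht hw f + laurentSum ht hw g := by
  refine (hasSeriesSum_laurentSum ht hw (f + g)).unique ?_
  simpa [add_mul] using (hasSeriesSum_laurentSum ht hw f).add (hasSeriesSum_laurentSum ht hw g)

/-- `laurentSum` as an additive homomorphism. -/
noncomputable def laurentSumAddHom : LaurentSeries (fixed σ) →+ SkewLaurent L σ :=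
  AddMonoidHom.mk' (laurentSum ht hw) (laurentSum_add ht hw)

theorem laurentSum_single (n : ℤ) (c : fixed σ) :
    laurentSum ht hw (HahnSeries.single n c) = const σ (c : L) * w ^ (-n) := by
  refine (hasSeriesSum_laurentSum ht hw _).unique ?_
  have := hasSeriesSum_of_finset (f := fun i =>
    const σ ((HahnSeries.single n c : LaurentSeries (fixed σ)).coeff i : L) * w ^ (-i)) {n}
    fun i hi => by
      rw [HahnSeries.coeff_single_of_ne (by simpa using hi)]
      simp
  simpa using this

/-- The powers `w ^ (-i)` with `i ≥ n` have degree at most `-n * t`; the `+ 1` makes the bound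
strict. -/
theorem degree_laurentSum_lt {f : LaurentSeries (fixed σ)} {n : ℤ}
    (hf : ∀ i, i < n → f.coeff i = 0) :
    (laurentSum ht hw f).degree < ((-n * t + 1 : ℤ) : WithBot ℤ) := by
  refine (hasSeriesSum_laurentSum ht hw f).degree_lt fun i => ?_
  by_cases hi : i < n
  · rw [hf i hi]
    simp [degree_zero, WithBot.bot_lt_coe]
  · refine degree_const_mul_lt ?_ _
    rw [degree_zpow_eq hw, WithBot.coe_lt_coe]
    have := mul_le_mul_of_nonneg_right (neg_le_neg (not_lt.1 hi)) ht.le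
    omega

theorem laurentSum_single_mul (n : ℤ) (c : fixed σ) (g : LaurentSeries (fixed σ)) :
    laurentSum ht hw (HahnSeries.single n c * g) =
      const σ (c : L) * w ^ (-n) * laurentSum ht hw g := by
  refine (hasSeriesSum_laurentSum ht hw _).unique ?_
  refine HasSeriesSum.comp_injective (e := fun i => i + n) (add_left_injective n)
    (fun i hi => absurd ⟨i - n, sub_add_cancel i n⟩ hi) ?_
  convert (hasSeriesSum_laurentSum ht hw g).mul_left (const σ (c : L) * w ^ (-n)) using 2 with i
  rw [HahnSeries.coeff_single_mul_add, Subfield.coe_mul, map_mul, neg_add_rev,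
    zpow_add₀ (ne_zero_of_degree_eq hw), mul_assoc, mul_assoc, ← mul_assoc (const σ _) (w ^ (-n)),
    const_fixed_mul_comm (g.coeff i), mul_assoc]

theorem coeff_mul_eq_zero_of_lt {f g : LaurentSeries (fixed σ)} {a b n : ℤ}
    (hf : ∀ i, i < a → f.coeff i = 0) (hg : ∀ i, i < b → g.coeff i = 0) (hn : n < a + b) :
    (f * g).coeff n = 0 := by
  rw [HahnSeries.coeff_mul]
  refine Finset.sum_eq_zero fun ij hij => ?_
  have h := (Finset.mem_antidiagonal.1 hij)
  rcases lt_or_ge ij.1 a with h1 | h1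
  · rw [hf _ h1, zero_mul]
  · rw [hg _ (by omega), mul_zero]

/-- By additivity and `laurentSum_single_mul` the formula holds when `f` is a finite sum of
monomials. The general case follows by continuity, replacing `f` by its truncations. -/
theorem laurentSum_mul (f g : LaurentSeries (fixed σ)) :
    laurentSum ht hw (f * g) = laurentSum ht hw f * laurentSum ht hw g := by
  refine HasSeriesSum.unique (f := fun i => const σ (f.coeff i : L) * w ^ (-i) * laurentSum ht hw g)
    (fun N => ?_) ((hasSeriesSum_laurentSum ht hw f).mul_right _)
  -- If `f` minus its truncation vanishes below `K`, its product with `g` vanishes below `K +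
  -- g.order = |N| + 1`, so the error has degree at most `-(|N| + 1) * t < N`.
  set K : ℤ := |N| + 1 - g.order with hK
  filter_upwards [eventually_ge_atTop (Finset.Icc f.order K)] with s hs
  have h1 : laurentSum ht hw (f * g) -
      ∑ i ∈ s, const σ (f.coeff i : L) * w ^ (-i) * laurentSum ht hw g =
      laurentSum ht hw ((f - ∑ i ∈ s, HahnSeries.single i (f.coeff i)) * g) := by
    change laurentSumAddHom ht hw _ - _ = laurentSumAddHom ht hw _
    rw [sub_mul, map_sub, Finset.sum_mul, map_sum]
    congr 1
    exact Finset.sum_congr rfl fun i _ => (laurentSum_single_mul ht hw i _ g).symm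
  rw [h1]
  refine lt_of_lt_of_le (degree_laurentSum_lt ht hw (n := |N| + 1) fun n hn =>
    coeff_mul_eq_zero_of_lt (a := K) (b := g.order) (fun i hi => ?_)
      (fun i hi => HahnSeries.coeff_eq_zero_of_lt_order hi) (by omega)) ?_
  · rw [HahnSeries.coeff_sub, HahnSeries.coeff_sum]
    by_cases his : i ∈ s
    · rw [Finset.sum_eq_single_of_mem i his
        fun j _ hj => HahnSeries.coeff_single_of_ne (Ne.symm hj)]
      simp
    · rw [Finset.sum_eq_zero fun j hj => HahnSeries.coeff_single_of_ne (by rintro rfl; exact his hj),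
        sub_zero]
      by_cases hi' : i < f.order
      · exact HahnSeries.coeff_eq_zero_of_lt_order hi'
      · exact absurd (hs (Finset.mem_Icc.2 ⟨by omega, by omega⟩)) his
  · rw [WithBot.coe_le_coe]
    have h2 := abs_nonneg N
    have h3 := neg_abs_le N
    nlinarith

/-- `laurentSum` as a homomorphism of `L^σ`-algebras. -/
noncomputable def laurentHom : LaurentSeries (fixed σ) →ₐ[fixed σ] SkewLaurent L σ where
  toFun := laurentSum ht hw
  map_one' := by
    have := laurentSum_single ht hw 0 1
    simpa using this
  map_zero' := (laurentSumAddHom ht hw).map_zero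
  map_add' := laurentSum_add ht hw
  map_mul' := laurentSum_mul ht hw
  commutes' c := by
    have := laurentSum_single ht hw 0 c
    rw [neg_zero, zpow_zero, mul_one] at this
    exact (congrArg (laurentSum ht hw) (HahnSeries.ofPowerSeries_C c)).trans this

theorem hasSeriesSum_laurentHom (f : LaurentSeries (fixed σ)) :
    HasSeriesSum (fun i => const σ (f.coeff i : L) * w ^ (-i)) (laurentHom ht hw f) :=
  hasSeriesSum_laurentSum ht hw f

theorem laurentHom_injective : Function.Injective (laurentHom ht hw) :=
  (laurentHom ht hw : LaurentSeries (fixed σ) →+* SkewLaurent L σ).injective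

theorem exists_fixed_bound_of_hasSeriesSum {e : ℤ → SkewLaurent L σ} (ht : 0 < t)
    (he : ∀ m, (e m).degree = ((m * t : ℤ) : WithBot ℤ)) {c : ℤ → fixed σ} {a : SkewLaurent L σ}
    (h : HasSeriesSum (fun i => const σ (c i : L) * e i) a) :
    ∃ M : ℤ, ∀ m, M < m → c m = 0 := by
  obtain ⟨M, hM⟩ := exists_bound_of_hasSeriesSum (c := fun i => (c i : L)) ht he h
  exact ⟨M, fun m hm => Subtype.ext (hM m hm)⟩

theorem range_laurentHom : Set.range (laurentHom ht hw) = laurentSet w := by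
  ext a
  constructor
  · rintro ⟨f, rfl⟩
    refine ⟨fun i => f.coeff (-i), ?_⟩
    simpa using (hasSeriesSum_laurentHom ht hw f).neg_index
  · rintro ⟨c, hc⟩
    obtain ⟨M, hM⟩ := exists_fixed_bound_of_hasSeriesSum ht (fun m => degree_zpow_eq hw m) hc
    refine ⟨HahnSeries.ofSuppBddBelow (fun i => c (-i)) ⟨-M, fun m hm => by
      by_contra h
      exact hm (hM _ (by omega))⟩, ?_⟩
    refine (hasSeriesSum_laurentHom ht hw _).unique ?_
    exact hc.neg_index

theorem laurentHom_mem_C {u : SkewLaurent L σ} (hwu : w ∈ C u) (f : LaurentSeries (fixed σ)) :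
    laurentHom ht hw f ∈ C u :=
  (hasSeriesSum_laurentHom ht hw f).mem_C fun _ =>
    (C u).mul_mem (const_fixed_mem_C u _) (zpow_mem_C hwu _)

end LaurentSum

theorem laurentSet_inv (w : SkewLaurent L σ) : laurentSet w⁻¹ = laurentSet w := by
  have key : ∀ w : SkewLaurent L σ, laurentSet w ⊆ laurentSet w⁻¹ := by
    rintro w a ⟨c, hc⟩
    exact ⟨fun i => c (-i), by simpa using hc.neg_index⟩
  exact Set.Subset.antisymm (by simpa using key w⁻¹) (key w)

/-! ### The centralizer of a series with non-fixed constant leading term -/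

/-- The coefficient of `X^n` in `l z = z l` reads `l z_n = z_n σ^n(l)`, which forces `z_n = 0` for
`n ≠ 0`. -/
theorem coe_C_const (horb : ∀ l : L, l ∉ fixed σ → ∀ i : ℕ, 1 ≤ i → (σ ^ i) l ≠ l) {l : L}
    (hl : l ∉ fixed σ) : (C (const σ l) : Set (SkewLaurent L σ)) = Set.range (const σ) := by
  ext z
  rw [SetLike.mem_coe, mem_C]
  constructor
  · intro h
    refine ⟨z.coeff 0, ?_⟩
    ext n
    rw [coeff_const]
    split_ifs with hn
    · rw [hn]
    · have h1 := congrArg (fun a => coeff a n) h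
      simp only [coeff_const_mul, coeff_mul_const] at h1
      rw [mul_comm] at h1
      by_contra hz
      exact hl (mem_fixed_of_zpow_apply horb hn (mul_left_cancel₀ (Ne.symm hz) h1).symm)
  · rintro ⟨m, rfl⟩
    rw [← map_mul, ← map_mul, mul_comm]

/-- The coefficients, at `X⁻ˢ`, of a series that conjugates `∑ aᵢ Xⁱ` to its constant term. -/
noncomputable def conjCoeff (σ : L ≃+* L) (a : ℤ → L) (s : ℕ) : L :=
  if s = 0 then 1 else (a 0 - (σ ^ (-(s : ℤ))) (a 0))⁻¹ *
    ∑ j : Fin s, conjCoeff σ a j * (σ ^ (-(j : ℤ))) (a ((j : ℤ) - s))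
  termination_by s
  decreasing_by exact j.2

/-- A series of degree zero with non-fixed leading coefficient is conjugate to that coefficient. -/
theorem exists_mul_eq_const_mul
    (horb : ∀ l : L, l ∉ fixed σ → ∀ i : ℕ, 1 ≤ i → (σ ^ i) l ≠ l) {u : SkewLaurent L σ}
    (hu : ∀ i, 0 < i → u.coeff i = 0) (hu0 : u.coeff 0 ∉ fixed σ) :
    ∃ x : SkewLaurent L σ, x.coeff 0 = 1 ∧ (∀ i, 0 < i → x.coeff i = 0) ∧
      x * u = const σ (u.coeff 0) * x := by
  let x : SkewLaurent L σ :=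
    ⟨fun n => if 0 < n then 0 else conjCoeff σ u.coeff n.natAbs, 0, fun n hn => if_pos hn⟩
  have hx : ∀ i, 0 < i → x.coeff i = 0 := fun i hi => if_pos hi
  have hx' : ∀ s : ℕ, x.coeff (-(s : ℤ)) = conjCoeff σ u.coeff s := fun s => by
    change (if 0 < (-(s : ℤ)) then 0 else conjCoeff σ u.coeff (-(s : ℤ)).natAbs) = _
    rw [if_neg (by omega), Int.natAbs_neg, Int.natAbs_natCast]
  refine ⟨x, (hx' 0).trans (by rw [conjCoeff, if_pos rfl]), hx, ?_⟩
  ext n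
  rw [coeff_const_mul]
  rcases lt_or_ge 0 n with hn | hn
  · rw [coeff_mul_of_lt hx hu (by omega), hx n hn, mul_zero]
  obtain ⟨s, rfl⟩ : ∃ s : ℕ, n = -(s : ℤ) := ⟨n.natAbs, by omega⟩
  have key : (x * u).coeff (-(s : ℤ)) = ∑ j ∈ Finset.range (s + 1),
      conjCoeff σ u.coeff j * (σ ^ (-(j : ℤ))) (u.coeff ((j : ℤ) - s)) := by
    rw [coeff_mul_eq_sum x u _ hx hu _ subset_rfl]
    refine Finset.sum_nbij' (fun j => j.natAbs) (fun k => -(k : ℤ)) ?_ ?_ ?_ ?_ ?_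
    · intro j hj
      simp only [Finset.mem_Icc, Finset.mem_range] at hj ⊢
      omega
    · intro j hj
      simp only [Finset.mem_Icc, Finset.mem_range] at hj ⊢
      omega
    · intro j hj
      simp only [Finset.mem_Icc] at hj ⊢
      omega
    · intro j hj
      simp only [Finset.mem_range] at hj ⊢
      omega
    · intro j hj
      simp only [Finset.mem_Icc] at hj ⊢
      have e1 : -((j.natAbs : ℕ) : ℤ) = j := by omega
      have e2 : ((j.natAbs : ℕ) : ℤ) - s = -(s : ℤ) - j := by omega
      rw [e1, e2, ← hx', e1]
  -- The last summand is `x_{-s} σ⁻ˢ(u₀)`. Moving it to the other side leaves the recursion defining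
  -- `conjCoeff`; for `s = 0` the equation is automatic.
  rw [key, Finset.sum_range_succ, sub_self, hx']
  by_cases hs : s = 0
  · subst hs
    simp [mul_comm]
  have hne : u.coeff 0 - (σ ^ (-(s : ℤ))) (u.coeff 0) ≠ 0 := fun h =>
    hu0 (mem_fixed_of_zpow_apply horb (by omega) (sub_eq_zero.1 h).symm)
  have hrec : (u.coeff 0 - (σ ^ (-(s : ℤ))) (u.coeff 0)) * conjCoeff σ u.coeff s =
      ∑ j ∈ Finset.range s,
        conjCoeff σ u.coeff j * (σ ^ (-(j : ℤ))) (u.coeff ((j : ℤ) - s)) := by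
    rw [conjCoeff, if_neg hs, mul_inv_cancel_left₀ hne, Finset.sum_range
      (fun j : ℕ => conjCoeff σ u.coeff j * (σ ^ (-(j : ℤ))) (u.coeff ((j : ℤ) - s)))]
  rw [← hrec]
  ring

/-- Conjugation by a unit, on the constants. -/
noncomputable def conjConst (x : SkewLaurent L σ) (hx : x ≠ 0) : L →+* SkewLaurent L σ where
  toFun l := x⁻¹ * const σ l * x
  map_one' := by rw [map_one, mul_one, inv_mul_cancel₀ hx]
  map_zero' := by simp
  map_add' l m := by rw [map_add, mul_add, add_mul]
  map_mul' l m := by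
    rw [map_mul, mul_assoc (x⁻¹ * const σ l), ← mul_assoc x, ← mul_assoc x, mul_inv_cancel₀ hx,
      one_mul]
    simp only [mul_assoc]

/-- The centralizer of a series of degree zero with non-fixed leading coefficient is a copy of
`L`. -/
theorem exists_ringHom_range_eq_C
    (horb : ∀ l : L, l ∉ fixed σ → ∀ i : ℕ, 1 ≤ i → (σ ^ i) l ≠ l) {u : SkewLaurent L σ}
    (hu : ∀ i, 0 < i → u.coeff i = 0) (hu0 : u.coeff 0 ∉ fixed σ) :
    ∃ ι : L →+* SkewLaurent L σ, Set.range ι = C u ∧ ι (u.coeff 0) = u ∧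
      (∀ c : fixed σ, ι c = const σ (c : L)) ∧
      ∀ l, (ι l).coeff 0 = l ∧ ∀ i, 0 < i → (ι l).coeff i = 0 := by
  obtain ⟨x, hx0, hx, hxu⟩ := exists_mul_eq_const_mul horb hu hu0
  have hdeg : x.degree = ((0 : ℤ) : WithBot ℤ) :=
    (degree_eq_iff x 0).2 ⟨by rw [hx0]; exact one_ne_zero, hx⟩
  have hne := ne_zero_of_degree_eq hdeg
  have hinv : ∀ i, 0 < i → x⁻¹.coeff i = 0 := by
    have h := ((degree_eq_iff _ _).1 (degree_inv_eq hdeg)).2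
    rwa [neg_zero] at h
  have hinv0 : x⁻¹.coeff 0 = 1 := by
    have h := coeff_mul_top hinv hx
    rw [inv_mul_cancel₀ hne, hx0] at h
    simpa [coeff_one] using h.symm
  have hconst : ∀ l : L, ∀ i, 0 < i → (const σ l).coeff i = 0 := fun l i hi =>
    if_neg (by omega)
  have hmid : ∀ l : L, ∀ i, 0 < i → (x⁻¹ * const σ l).coeff i = 0 := fun l i hi =>
    coeff_mul_of_lt hinv (hconst l) (by omega)
  have hu' : u = x⁻¹ * const σ (u.coeff 0) * x := by
    rw [mul_assoc, ← hxu, inv_mul_cancel_left₀ hne]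
  refine ⟨conjConst x hne, ?_, hu'.symm, fun c => ?_, fun l => ⟨?_, fun i hi => ?_⟩⟩
  · ext z
    constructor
    · rintro ⟨l, rfl⟩
      rw [SetLike.mem_coe, mem_C]
      have h : conjConst x hne (u.coeff 0) * conjConst x hne l =
          conjConst x hne l * conjConst x hne (u.coeff 0) := by
        rw [← map_mul, ← map_mul, mul_comm]
      rwa [show conjConst x hne (u.coeff 0) = u from hu'.symm] at h
    · intro hz
      -- Conjugation by `x` carries `C(u)` to the centralizer of the constant `u₀`, which is `L`.
      have hz' : x * z * x⁻¹ ∈ C (const σ (u.coeff 0)) := by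
        rw [mem_C, ← mul_assoc, ← mul_assoc, ← hxu, mul_assoc x u z, mem_C.1 hz]
        simp only [mul_assoc]
        congr 2
        rw [eq_inv_mul_iff_mul_eq₀ hne, ← mul_assoc, hxu, mul_inv_cancel_right₀ hne]
      rw [← SetLike.mem_coe, coe_C_const horb hu0] at hz'
      obtain ⟨l, hl⟩ := hz'
      refine ⟨l, ?_⟩
      change x⁻¹ * const σ l * x = z
      rw [hl, mul_assoc, inv_mul_cancel_right₀ hne, inv_mul_cancel_left₀ hne]
  · change x⁻¹ * const σ (c : L) * x = _
    rw [mul_assoc, const_fixed_mul_comm, inv_mul_cancel_left₀ hne]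
  · have h1 := coeff_mul_top (hmid l) hx
    have h2 := coeff_mul_top hinv (hconst l)
    rw [add_zero] at h1 h2
    refine h1.trans ?_
    rw [h2, hinv0, hx0, coeff_const, if_pos rfl]
    simp
  · exact coeff_mul_of_lt (hmid l) hx (by omega)

/-- The embedding `ι` of `L` onto `C(u)` is a section of the residue map, which gives bijectivity.
It also carries `L^σ(u₀)` onto `L^σ(u)`, so the two dimensions agree. -/
theorem degree_zero_case (horb : ∀ l : L, l ∉ fixed σ → ∀ i : ℕ, 1 ≤ i → (σ ^ i) l ≠ l)
    {u : SkewLaurent L σ} (hu : ∀ i, 0 < i → u.coeff i = 0) (hu0 : u.coeff 0 ∉ fixed σ) :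
    (∃ h : C u ≤ nonpos σ,
      Function.Bijective ((residue σ).comp (Subalgebra.inclusion h) : C u →ₐ[fixed σ] L)) ∧
    (∃ h : (Subfield.closure (const σ '' (fixed σ) ∪ {u})).toSubring ≤ (C u).toSubring,
      relDim h = Module.rank (Subfield.closure ((fixed σ : Set L) ∪ {u.coeff 0})) L) := by
  obtain ⟨ι, hιC, hιu, hιc, hι⟩ := exists_ringHom_range_eq_C horb hu hu0
  have hmem : ∀ z ∈ C u, ∃ l, ι l = z := fun z hz => by
    rwa [← SetLike.mem_coe, ← hιC] at hz
  have hmem' : ∀ l, ι l ∈ C u := fun l => by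
    rw [← SetLike.mem_coe, ← hιC]
    exact ⟨l, rfl⟩
  have hF : (Subfield.closure ((fixed σ : Set L) ∪ {u.coeff 0})).map ι =
      Subfield.closure (const σ '' (fixed σ) ∪ {u}) := by
    rw [RingHom.map_field_closure, Set.image_union, Set.image_singleton, hιu]
    congr 2
    exact Set.image_congr fun c hc => hιc ⟨c, hc⟩
  constructor
  · refine ⟨fun z hz => ?_, ?_, fun l => ⟨⟨ι l, hmem' l⟩, (hι l).1⟩⟩
    · obtain ⟨l, rfl⟩ := hmem z hz
      exact mem_nonpos.2 (hι l).2
    · rintro ⟨y, hy⟩ ⟨z, hz⟩ hyz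
      obtain ⟨l, rfl⟩ := hmem y hy
      obtain ⟨m, rfl⟩ := hmem z hz
      have : (ι l).coeff 0 = (ι m).coeff 0 := hyz
      rw [(hι l).1, (hι m).1] at this
      subst this
      rfl
  · have hle : (Subfield.closure (const σ '' (fixed σ) ∪ {u})).toSubring ≤ (C u).toSubring := by
      rw [← hF]
      rintro _ ⟨l, _, rfl⟩
      exact hmem' l
    refine ⟨hle, ?_⟩
    refine relDim_eq_rank hle
      (fun r => ⟨ι r, by
        rw [← hF]
        exact ⟨r, r.2, rfl⟩⟩)
      (AddEquiv.ofBijective ((ι : L →+ SkewLaurent L σ).codRestrict (C u).toSubring hmem') ⟨?_, ?_⟩)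
      ⟨?_, ?_⟩ fun r m => map_mul ι _ _
    · exact fun l m h => ι.injective (congrArg Subtype.val h)
    · rintro ⟨z, hz⟩
      obtain ⟨l, rfl⟩ := hmem z hz
      exact ⟨l, rfl⟩
    · exact fun l m h => Subtype.ext (ι.injective (congrArg Subtype.val h))
    · rintro ⟨z, hz⟩
      rw [← hF] at hz
      obtain ⟨l, hl, rfl⟩ := hz
      exact ⟨⟨l, hl⟩, rfl⟩

/-! ### The centralizer of a series of nonzero degree -/

/-- Passing to `u⁻¹` when `d < 0` makes the degree positive without changing the Laurent series set.
-/
theorem exists_pos_degree_mem_C {u : SkewLaurent L σ} {d : ℤ} (hd : d ≠ 0) (hu : u.degree = d) :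
    ∃ w ∈ C u, ∃ d' : ℤ, 0 < d' ∧ w.degree = d' ∧ |d| = d' ∧ laurentSet w = laurentSet u := by
  rcases lt_or_gt_of_ne hd with h | h
  · exact ⟨u⁻¹, inv_mem_C (self_mem_C u), -d, by omega, degree_inv_eq hu, abs_of_neg h,
      laurentSet_inv u⟩
  · exact ⟨u, self_mem_C u, d, h, hu, abs_of_pos h, rfl⟩

theorem exists_least_degree_mem_C {u : SkewLaurent L σ} {d : ℤ} (hd : d ≠ 0) (hu : u.degree = d) :
    ∃ v ∈ C u, ∃ t : ℤ, 0 < t ∧ v.degree = t ∧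
      ∀ w ∈ C u, ((0 : ℤ) : WithBot ℤ) < w.degree → v.degree ≤ w.degree := by
  obtain ⟨w, hw, d', hd', hwd, -⟩ := exists_pos_degree_mem_C hd hu
  obtain ⟨t, ⟨ht, v, hv, hvt⟩, hmin⟩ := Int.exists_least_of_bdd
    (P := fun t : ℤ => 0 < t ∧ ∃ v ∈ C u, v.degree = t) ⟨0, fun z hz => hz.1.le⟩
    ⟨d', hd', w, hw, hwd⟩
  refine ⟨v, hv, t, ht, hvt, fun w hw h => ?_⟩
  obtain ⟨n, hn⟩ := exists_degree_eq (a := w) (by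
    rintro rfl
    rw [degree_zero] at h
    exact not_lt_bot h)
  rw [hn, WithBot.coe_lt_coe] at h
  rw [hn, hvt, WithBot.coe_le_coe]
  exact hmin n ⟨h, w, hw, hn⟩

section NonzeroDegree

variable (horb : ∀ l : L, l ∉ fixed σ → ∀ i : ℕ, 1 ≤ i → (σ ^ i) l ≠ l) {u v : SkewLaurent L σ}
  {d t : ℤ} (hd : d ≠ 0) (hu : u.degree = d) (ht : 0 < t) (hv : v ∈ C u) (hvt : v.degree = t)
  (hmin : ∀ w ∈ C u, ((0 : ℤ) : WithBot ℤ) < w.degree → v.degree ≤ w.degree)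

include horb hd hu ht hv hvt hmin

theorem coe_C_eq_laurentSet : (C u : Set (SkewLaurent L σ)) = laurentSet v := by
  refine Set.Subset.antisymm (fun z hz => ?_) ?_
  · exact exists_expansion horb hd hu ht (fun w hw n hn => dvd_degree_of_mem_C ht hv hvt hmin hw hn)
      (fun m => zpow_mem_C hv m) (fun m => degree_zpow_eq hvt m) hz
  · rintro z ⟨c, hc⟩
    exact hc.mem_C fun i => (C u).mul_mem (const_fixed_mem_C u _) (zpow_mem_C hv _)

theorem exists_algEquiv_C :
    ∃ φ : LaurentSeries (fixed σ) ≃ₐ[fixed σ] C u, ∀ f : LaurentSeries (fixed σ),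
      HasSeriesSum (fun i => const σ (f.coeff i : L) * v ^ (-i)) (φ f) := by
  refine ⟨AlgEquiv.ofBijective ((laurentHom ht hvt).codRestrict (C u) (laurentHom_mem_C ht hvt hv))
    ⟨fun f g h => laurentHom_injective ht hvt (congrArg Subtype.val h), ?_⟩,
    fun f => hasSeriesSum_laurentHom ht hvt f⟩
  rintro ⟨z, hz⟩
  have hz' := hz
  rw [← SetLike.mem_coe, coe_C_eq_laurentSet horb hd hu ht hv hvt hmin,
    ← range_laurentHom ht hvt] at hz'
  obtain ⟨f, rfl⟩ := hz'
  exact ⟨f, rfl⟩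

/-- For `w` in the centralizer whose degree is `n` times the least positive degree, the powers
`1, v, …, v ^ (n - 1)` form a basis of the centralizer over the Laurent series in `w`. -/
theorem bijective_sum_laurentHom_mul_pow {w : SkewLaurent L σ} {d' : ℤ} (hd' : 0 < d')
    (hw : w ∈ C u) (hwd : w.degree = d') (n : ℕ) [NeZero n] (hn : d' = n * t) :
    Function.Injective (fun g : Fin n → LaurentSeries (fixed σ) =>
      ∑ r, laurentHom hd' hwd (g r) * v ^ (r : ℕ)) ∧
    ∀ z ∈ C u, ∃ g : Fin n → LaurentSeries (fixed σ),
      ∑ r, laurentHom hd' hwd (g r) * v ^ (r : ℕ) = z := by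
  -- Writing `m = q n + r` with `0 ≤ r < n`, the element `w^q v^r` has degree `q n t + r t = m t`,
  -- so the family has exactly one member for each multiple of `t`.
  set E := Int.divModEquiv n with hE
  have hEsymm : ∀ (q : ℤ) (r : Fin n), E.symm (q, r) = q * n + (r : ℕ) := fun q r => rfl
  set e : ℤ → SkewLaurent L σ := fun m => w ^ (E m).1 * v ^ ((E m).2 : ℕ) with he_def
  have he : ∀ m, (e m).degree = ((m * t : ℤ) : WithBot ℤ) := fun m => by
    rw [he_def]
    dsimp only
    rw [degree_mul_eq (degree_zpow_eq hwd _) (degree_pow_eq hvt _), WithBot.coe_inj, hn]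
    have := hEsymm (E m).1 (E m).2
    rw [Prod.mk.eta, Equiv.symm_apply_apply] at this
    nth_rewrite 3 [this]
    ring
  have heC : ∀ m, e m ∈ C u := fun m =>
    (C u).mul_mem (zpow_mem_C hw _) ((C u).pow_mem hv _)
  have hsum : ∀ g : Fin n → LaurentSeries (fixed σ),
      HasSeriesSum (fun m => const σ ((g (E m).2).coeff (-(E m).1) : L) * e m)
        (∑ r, laurentHom hd' hwd (g r) * v ^ (r : ℕ)) := by
    intro g
    -- The series of the `r`-th summand, extended by zero from the residue class of `r` modulo `n`
    -- to all of `ℤ`; adding over `r` interleaves these series.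
    have h1 : ∀ r ∈ Finset.univ, HasSeriesSum
        (fun m => if (E m).2 = r then const σ ((g r).coeff (-(E m).1) : L) * e m else 0)
        (laurentHom hd' hwd (g r) * v ^ (r : ℕ)) := by
      intro r _
      refine HasSeriesSum.comp_injective (e := fun q => E.symm (q, r))
        (fun p q h => congrArg Prod.fst (E.symm.injective h)) (fun m hm => ?_) ?_
      · rw [if_neg]
        rintro rfl
        exact hm ⟨(E m).1, E.symm_apply_apply m⟩
      · convert ((hasSeriesSum_laurentHom hd' hwd (g r)).neg_index).mul_right (v ^ (r : ℕ)) using 2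
          with q
        simp only [he_def, Equiv.apply_symm_apply, if_true, neg_neg, mul_assoc]
    convert HasSeriesSum.sum h1 using 2 with m
    rw [Finset.sum_ite_eq, if_pos (Finset.mem_univ _)]
  constructor
  · have hadd : ∀ g : Fin n → LaurentSeries (fixed σ), (∑ r, laurentHom hd' hwd (g r) * v ^ (r : ℕ)) = 0 → g = 0 := by
      intro g hg
      have h0 := hsum g
      rw [hg] at h0
      ext r q
      have := coeffs_eq_zero_of_hasSeriesSum_zero
        (c := fun m => ((g (E m).2).coeff (-(E m).1) : L)) ht he h0 (E.symm (-q, r))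
      simpa using this
    intro g g' hgg
    rw [← sub_eq_zero]
    apply hadd
    rw [← sub_eq_zero] at hgg
    simpa [← Finset.sum_sub_distrib, ← sub_mul] using hgg
  · intro z hz
    obtain ⟨c, hc⟩ := exists_expansion horb hd hu ht
      (fun w hw n hn => dvd_degree_of_mem_C ht hv hvt hmin hw hn) heC he hz
    obtain ⟨M, hM⟩ := exists_fixed_bound_of_hasSeriesSum ht he hc
    have hn1 : (1 : ℤ) ≤ n := by exact_mod_cast NeZero.one_le
    -- Collecting the terms of an expansion by residue class gives the coordinates. For `q < -|M|`
    -- the index `-q * n + r` exceeds `M`, since `n ≥ 1`, and its coefficient vanishes.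
    refine ⟨fun r => HahnSeries.ofSuppBddBelow (fun q => c (E.symm (-q, r))) ⟨-|M|, fun q hq => ?_⟩,
      (hsum _).unique ?_⟩
    · by_contra h
      refine hq (hM _ ?_)
      rw [hEsymm]
      have h1 := le_abs_self M
      have h2 := abs_nonneg M
      nlinarith [Int.natCast_nonneg (r : ℕ)]
    · convert hc using 4 with m
      change ((c (E.symm (- -(E m).1, (E m).2)) : fixed σ) : L) = c m
      rw [neg_neg, Prod.mk.eta, Equiv.symm_apply_apply]

/-- The subfield is the image of `laurentHom` for `w = u` or `u⁻¹`, and `n` is the quotient of `deg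
w = |d|` by `t`. -/
theorem exists_subfield_laurentSet :
    ∃ F : Subfield (SkewLaurent L σ), (F : Set (SkewLaurent L σ)) = laurentSet u ∧
      ∃ h : F.toSubring ≤ (C u).toSubring, ∃ n : ℕ,
        (n : ℚ) = |(d : ℚ) / (t : ℚ)| ∧ relDim h = n := by
  obtain ⟨w, hw, d', hd', hwd, habs, hset⟩ := exists_pos_degree_mem_C hd hu
  obtain ⟨q, hq⟩ := dvd_degree_of_mem_C ht hv hvt hmin hw hwd
  have hq0 : 0 < q := by
    rw [hq] at hd'
    exact pos_of_mul_pos_right hd' ht.le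
  obtain ⟨n, rfl⟩ := Int.eq_ofNat_of_zero_le hq0.le
  have : NeZero n := ⟨by omega⟩
  have hle : (laurentHom hd' hwd : LaurentSeries (fixed σ) →+* SkewLaurent L σ).fieldRange.toSubring
      ≤ (C u).toSubring := by
    rintro _ ⟨f, rfl⟩
    exact laurentHom_mem_C hd' hwd hw f
  obtain ⟨hinj, hsurj⟩ := bijective_sum_laurentHom_mul_pow horb hd hu ht hv hvt hmin hd' hw hwd n
    (by rw [hq, mul_comm])
  have hmem : ∀ g : Fin n → LaurentSeries (fixed σ),
      ∑ r, laurentHom hd' hwd (g r) * v ^ (r : ℕ) ∈ C u := fun g =>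
    (C u).sum_mem fun r _ => (C u).mul_mem (laurentHom_mem_C hd' hwd hw _) ((C u).pow_mem hv _)
  refine ⟨(laurentHom hd' hwd : LaurentSeries (fixed σ) →+* SkewLaurent L σ).fieldRange, ?_, hle,
    n, ?_, ?_⟩
  · rw [← hset, ← range_laurentHom hd' hwd]
    ext z
    exact Iff.rfl
  · have ht' : (0 : ℚ) < t := by exact_mod_cast ht
    have h1 : |(d : ℚ)| = t * n := by
      rw [← Int.cast_abs, habs, hq]
      push_cast
      rfl
    rw [abs_div, h1, abs_of_pos ht', mul_div_cancel_left₀ _ ht'.ne']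
  · let j : (Fin n → LaurentSeries (fixed σ)) →+ (C u).toSubring :=
      AddMonoidHom.mk' (fun g => ⟨_, hmem g⟩)
        fun g g' => Subtype.ext (by simp [add_mul, Finset.sum_add_distrib])
    have hj : Function.Bijective j := ⟨fun g g' h => hinj (congrArg Subtype.val h), fun z =>
      let ⟨g, hg⟩ := hsurj z z.2
      ⟨g, Subtype.ext hg⟩⟩
    rw [relDim_eq_rank hle (fun f => ⟨laurentHom hd' hwd f, f, rfl⟩) (AddEquiv.ofBijective j hj)
      ⟨fun f g h => laurentHom_injective hd' hwd (congrArg Subtype.val h), ?_⟩ fun f g => ?_,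
      rank_fun', Fintype.card_fin]
    · rintro ⟨_, f, rfl⟩
      exact ⟨f, rfl⟩
    · change ∑ r, laurentHom hd' hwd (f * g r) * v ^ (r : ℕ) =
        laurentHom hd' hwd f * ∑ r, laurentHom hd' hwd (g r) * v ^ (r : ℕ)
      simp [Finset.mul_sum, mul_assoc]

end NonzeroDegree

/-! ### Commutativity of centralizers -/

theorem commute_of_degree_ne_zero
    (horb : ∀ l : L, l ∉ fixed σ → ∀ i : ℕ, 1 ≤ i → (σ ^ i) l ≠ l) {u : SkewLaurent L σ} {d : ℤ}
    (hd : d ≠ 0) (hu : u.degree = d) {y z : SkewLaurent L σ} (hy : y ∈ C u) (hz : z ∈ C u) :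
    y * z = z * y := by
  obtain ⟨v, hv, t, ht, hvt, hmin⟩ := exists_least_degree_mem_C hd hu
  obtain ⟨φ, -⟩ := exists_algEquiv_C horb hd hu ht hv hvt hmin
  obtain ⟨f, hf⟩ := φ.surjective ⟨y, hy⟩
  obtain ⟨g, hg⟩ := φ.surjective ⟨z, hz⟩
  have h : φ f * φ g = φ g * φ f := by rw [← map_mul, ← map_mul, mul_comm]
  rw [hf, hg] at h
  exact congrArg Subtype.val h

/-- The remaining case is degree zero with leading coefficient `c ∈ L^σ`. Then `u - c` is nonzero
without constant term, so its degree is nonzero, and its centralizer contains `C(u)` because `c` is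
central. -/
theorem commute_of_not_mem_range
    (horb : ∀ l : L, l ∉ fixed σ → ∀ i : ℕ, 1 ≤ i → (σ ^ i) l ≠ l) {u : SkewLaurent L σ}
    (hu : ∀ c : fixed σ, u ≠ const σ (c : L)) {y z : SkewLaurent L σ} (hy : y ∈ C u)
    (hz : z ∈ C u) : y * z = z * y := by
  obtain ⟨d, hd⟩ := exists_degree_eq (a := u) (by simpa using hu 0)
  by_cases hd0 : d = 0
  · subst hd0
    have hu' := ((degree_eq_iff _ _).1 hd).2
    by_cases hf : u.coeff 0 ∈ fixed σ
    · set c : fixed σ := ⟨u.coeff 0, hf⟩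
      obtain ⟨n, hn⟩ := exists_degree_eq (sub_ne_zero.2 (hu c))
      have hmem : ∀ a ∈ C u, a ∈ C (u - const σ (c : L)) := fun a ha => by
        rw [mem_C, sub_mul, mul_sub, mem_C.1 ha, const_fixed_mul_comm]
      refine commute_of_degree_ne_zero horb ?_ hn (hmem y hy) (hmem z hz)
      rintro rfl
      refine ((degree_eq_iff _ _).1 hn).1 ?_
      rw [coeff_sub, coeff_const, if_pos rfl, sub_self]
    · obtain ⟨ι, hι, -⟩ := exists_ringHom_range_eq_C horb hu' hf
      rw [← SetLike.mem_coe, ← hι] at hy hz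
      obtain ⟨l, rfl⟩ := hy
      obtain ⟨m, rfl⟩ := hz
      rw [← map_mul, ← map_mul, mul_comm]
  · exact commute_of_degree_ne_zero horb hd0 hd hy hz

theorem commutativeCentralizerCondition (hσ : σ ≠ RingEquiv.refl L)
    (horb : ∀ l : L, l ∉ fixed σ → ∀ i : ℕ, 1 ≤ i → (σ ^ i) l ≠ l) :
    CommutativeCentralizerCondition (SkewLaurent L σ) := by
  constructor
  · obtain ⟨l, hl⟩ : ∃ l, σ l ≠ l := by
      by_contra! h
      exact hσ (RingEquiv.ext h)
    -- If `σ l ≠ l`, then `X l = σ(l) X` differs from `l X`.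
    refine ⟨monomial σ 1 1, const σ l, fun h => hl ?_⟩
    have h1 := congrArg (fun a => coeff a 1) h
    simpa [coeff_const_mul, coeff_mul_const, coeff_monomial] using h1
  · intro a ha y hy z hz
    refine commute_of_not_mem_range horb (u := a) ?_
      (mem_C.2 (Subring.mem_centralizer_iff.1 hy a rfl))
      (mem_C.2 (Subring.mem_centralizer_iff.1 hz a rfl))
    rintro c rfl
    exact ha (Subring.mem_center_iff.2 fun g => (const_fixed_mul_comm c g).symm)

end SkewLaurent

/-! ### The main theorem -/

open SkewLaurent in
theorem mainTheorem7 {L : Type u} [Field L] (σ : L ≃+* L) (hσ : σ ≠ RingEquiv.refl L)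
    (horb : ∀ l : L, l ∉ fixed σ → ∀ i : ℕ, 1 ≤ i → (σ ^ i) l ≠ l) :
    CommutativeCentralizerCondition (SkewLaurent L σ) ∧
    (∀ u : L, u ∉ fixed σ → (C (const σ u) : Set (SkewLaurent L σ)) = Set.range (const σ)) ∧
    (∀ u : SkewLaurent L σ, u ∉ Set.range (const σ) → u.degree = ((0 : ℤ) : WithBot ℤ) →
      u.coeff 0 ∉ fixed σ →
      (∃ h : C u ≤ nonpos σ,
        Function.Bijective ((residue σ).comp (Subalgebra.inclusion h) : C u →ₐ[fixed σ] L)) ∧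
      (∃ h : (Subfield.closure (const σ '' (fixed σ) ∪ {u})).toSubring ≤ (C u).toSubring,
        relDim h = Module.rank (Subfield.closure ((fixed σ : Set L) ∪ {u.coeff 0})) L)) ∧
    (∀ u : SkewLaurent L σ, u ∉ Set.range (const σ) → u.degree ≠ ((0 : ℤ) : WithBot ℤ) →
      (∃ v ∈ C u, ((0 : ℤ) : WithBot ℤ) < v.degree) ∧
      ∀ v ∈ C u, ((0 : ℤ) : WithBot ℤ) < v.degree →
        (∀ w ∈ C u, ((0 : ℤ) : WithBot ℤ) < w.degree → v.degree ≤ w.degree) →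
        (C u : Set (SkewLaurent L σ)) = laurentSet v ∧
        (∃ φ : LaurentSeries (fixed σ) ≃ₐ[fixed σ] C u, ∀ f : LaurentSeries (fixed σ),
          HasSeriesSum (fun i => const σ (f.coeff i : L) * v ^ (-i)) (φ f)) ∧
        ∃ F : Subfield (SkewLaurent L σ), (F : Set (SkewLaurent L σ)) = laurentSet u ∧
          ∃ h : F.toSubring ≤ (C u).toSubring, ∃ d t : ℤ, ∃ n : ℕ,
            u.degree = d ∧ v.degree = t ∧ (n : ℚ) = |(d : ℚ) / (t : ℚ)| ∧ relDim h = n) := by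
  refine ⟨commutativeCentralizerCondition hσ horb, fun u hu => coe_C_const horb hu,
    fun u _ hu hu0 => degree_zero_case horb ((degree_eq_iff _ _).1 hu).2 hu0, fun u hu hu0 => ?_⟩
  obtain ⟨d, hd⟩ := exists_degree_eq (a := u) (by
    rintro rfl
    exact hu ⟨0, map_zero _⟩)
  have hd0 : d ≠ 0 := by
    rintro rfl
    exact hu0 hd
  refine ⟨?_, fun v hv hv0 hmin => ?_⟩
  · obtain ⟨w, hw, d', hd', hwd, -⟩ := exists_pos_degree_mem_C hd0 hd
    exact ⟨w, hw, by rwa [hwd, WithBot.coe_lt_coe]⟩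
  · obtain ⟨t, hvt⟩ := exists_degree_eq (a := v) (by
      rintro rfl
      rw [degree_zero] at hv0
      exact not_lt_bot hv0)
    have ht : 0 < t := by rwa [hvt, WithBot.coe_lt_coe] at hv0
    obtain ⟨F, hF, h, n, hn, hrel⟩ := exists_subfield_laurentSet horb hd0 hd ht hv hvt hmin
    exact ⟨coe_C_eq_laurentSet horb hd0 hd ht hv hvt hmin,
      exists_algEquiv_C horb hd0 hd ht hv hvt hmin, F, hF, h, d, t, n, hd, hvt, hn, hrel⟩
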